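/- **Theorem 5 (Sobolev-like inequalities for Orlicz spaces).** Let $n\ge 1$. Let $a:[0,\infty)\to[0,\infty)$ be a nondecreasing left-continuous function with $a(0)=0$, and let $A(t)=\int_0^t a(\sigma)\,d\sigma$ be the associated Young function; assume that $A$ is not identically zero and that $A\in\nabla_2$, i.e. there is a constant $C_0>1$ such that $A(r)\le \frac1{2C_0}A(C_0r)$ for all $r\ge0$. For a function $\Phi:[0,\infty)\to[0,\infty)$ and a measurable function $g$ on $\mathbb{R}^n$ put $$\|g\|_{L^{\Phi}}=\inf\Big\{\lambda>0:\ \int_{\mathbb{R}^n}\Phi\big(|g(x)|/\lambda\big)\,dx\le 1\Big\}\in[0,\infty],$$ and let $L^\Phi(\mathbb{R}^n)$ be the set of measurable $g$ with $\|g\|_{L^\Phi}<\infty$. For a tempered distribution $f$ on $\mathbb{R}^n$ and $\beta>0$ put $$\|f\|_{\dot B^{-\beta,\infty}_\infty}=\sup_{t>0}t^{\beta/2}\|h_t*f\|_{L^\infty},\qquad h_t(x)=(4\pi t)^{-n/2}e^{-|x|^2/(4t)},$$ and write $f\in\dot B^{-\beta,\infty}_\infty(\mathbb{R}^n)$ if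 this quantity is finite. For $\sigma\ge 0$ we write $F=(-\Delta)^{\sigma/2}f$ if $F$ is a tempered distribution with $\widehat F(\xi)=|\xi|^{\sigma}\widehat f(\xi)$ on $\mathbb{R}^n\setminus\{0\}$ and without zero-frequency part, i.e. such that for every $\chi\in C_c^\infty(\mathbb{R}^n)$ the tempered distributions with Fourier transform $\chi(R\,\xi)\widehat F(\xi)$ tend to $0$ in $\mathcal{S}'(\mathbb{R}^n)$ as $R\to\infty$; there is at most one such $F$. Let $0\le s_1<s$ and $\beta>0$, and set $\theta=\frac{s-s_1}{\beta+s}\in(0,1)$. Let $L^A_{(1-\theta)}(\mathbb{R}^n)$ be the rescaled Orlicz space $L^{B}(\mathbb{R}^n)$ with $B(t)=A\big(t^{1/(1-\theta)}\big)$; equivalently, $\|g\|_{L^A_{(1-\theta)}}=\big\|\,|g|^{1/(1-\theta)}\big\|_{L^A}^{1-\theta}$. Then there is a constant $C$, depending only on $n,A,s,s_1,\beta$, such that the following holds. Let $f$ be a tempered distribution on $\mathbb{R}^n$ (for instance, one given by a measurable function) such that $f\in\dot B^{-\beta,\infty}_\infty(\mathbb{R}^n)$ and $(-\Delta)^{s/2}f$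 is a function in $L^A(\mathbb{R}^n)$. Then $(-\Delta)^{s_1/2}f$ is a function in $L^A_{(1-\theta)}(\mathbb{R}^n)$, and $$\big\|(-\Delta)^{s_1/2}f\big\|_{L^A_{(1-\theta)}}\le C\,\big\|(-\Delta)^{s/2}f\big\|_{L^A}^{1-\theta}\,\|f\|_{\dot B^{-\beta,\infty}_\infty}^{\theta}.$$ -/

import Mathlib

open MeasureTheory Filter Topology
open scoped NNReal ENNReal SchwartzMap FourierTransform ContDiff

noncomputable section

/-! ## Young functions, Luxemburg norms, Orlicz spaces -/

/-- `A` is a Young function: `A t = ∫ σ in 0..t, a σ` for some nondecreasing left-continuous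
`a : [0, ∞) → [0, ∞)` with `a 0 = 0`. -/
def IsYoungFunction (A : ℝ≥0 → ℝ≥0) : Prop :=
  ∃ a : ℝ≥0 → ℝ≥0, Monotone a ∧ (∀ t, ContinuousWithinAt a (Set.Iic t) t) ∧ a 0 = 0 ∧
    ∀ t : ℝ≥0, (A t : ℝ) = ∫ σ in (0 : ℝ)..t, (a σ.toNNReal : ℝ)

/-- The `∇₂` condition. -/
def Nabla2 (A : ℝ≥0 → ℝ≥0) : Prop :=
  ∃ C : ℝ≥0, 1 < C ∧ ∀ r, A r ≤ 1 / (2 * C) * A (C * r)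

/-- The rescaled function `A_σ(t) = A(t ^ σ)`. -/
def rescale (A : ℝ≥0 → ℝ≥0) (σ : ℝ) : ℝ≥0 → ℝ≥0 := fun t => A (t ^ σ)

/-- The Luxemburg functional `inf {l > 0 : ∫ A(|g| / l) ≤ 1}`, with value `∞` when there is no
such `l`. -/
def luxemburgNorm {n : ℕ} (A : ℝ≥0 → ℝ≥0) (g : EuclideanSpace ℝ (Fin n) → ℂ) : ℝ≥0∞ :=
  ⨅ (l : ℝ≥0) (_ : 0 < l) (_ : ∫⁻ x, (A (‖g x‖₊ / l) : ℝ≥0∞) ≤ 1), (l : ℝ≥0∞)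

/-- Membership of the Orlicz space of `A`: `g` is measurable (up to a null set) and its Luxemburg
norm is finite. -/
def MemOrlicz {n : ℕ} (A : ℝ≥0 → ℝ≥0) (g : EuclideanSpace ℝ (Fin n) → ℂ) : Prop :=
  AEStronglyMeasurable g volume ∧ luxemburgNorm A g < ⊤

/-! ## The heat kernel and the Besov space of negative regularity -/

theorem gaussian_decay {E : Type*} [NormedAddCommGroup E] [InnerProductSpace ℝ E] {b : ℝ}
    (hb : 0 < b) (k n : ℕ) :
    ∃ C : ℝ, ∀ x : E, ‖x‖ ^ k * ‖iteratedFDeriv ℝ n (fun y : E => Real.exp (-b * ‖y‖ ^ 2)) x‖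
      ≤ C := by
  have hf : (fun y : E => -b * ‖y‖ ^ 2).HasTemperateGrowth :=
    (Function.HasTemperateGrowth.const (-b)).mul (Function.hasTemperateGrowth_norm_sq (H := E))
  obtain ⟨m, C, hC, hbound⟩ := hf.norm_iteratedFDeriv_le_uniform n
  refine ⟨n.factorial * (C + 1) ^ n *
    ((k + m * n).factorial * Real.exp (1 + 1 / (4 * b))), fun x => ?_⟩
  set r := ‖x‖ with hr
  have hr0 : 0 ≤ r := norm_nonneg x
  have h1 : (1 : ℝ) ≤ (1 + r) ^ m := one_le_pow₀ (by linarith)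
  have hD1 : 1 ≤ (C + 1) * (1 + r) ^ m := by nlinarith
  have key : ‖iteratedFDeriv ℝ n (Real.exp ∘ fun y : E => -b * ‖y‖ ^ 2) x‖
      ≤ n.factorial * Real.exp (-b * r ^ 2) * ((C + 1) * (1 + r) ^ m) ^ n := by
    refine norm_iteratedFDeriv_comp_le (N := ∞) Real.contDiff_exp hf.1
      (by exact_mod_cast le_top) x ?_ ?_
    · intro i _
      rw [norm_iteratedFDeriv_eq_norm_iteratedDeriv, iteratedDeriv_eq_iterate, Real.iter_deriv_exp,
        Real.norm_eq_abs, Real.abs_exp]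
    · intro i hi hin
      calc _ ≤ C * (1 + r) ^ m := hbound i hin x
        _ ≤ (C + 1) * (1 + r) ^ m := by nlinarith
        _ ≤ _ := le_self_pow₀ hD1 (by omega)
  have hpow : (1 + r) ^ (k + m * n) ≤ (k + m * n).factorial * Real.exp (1 + r) := by
    have := Real.pow_div_factorial_le_exp (1 + r) (by linarith) (k + m * n)
    rwa [div_le_iff₀ (by positivity), mul_comm (Real.exp _)] at this
  have hexp : Real.exp (1 + r) * Real.exp (-b * r ^ 2) ≤ Real.exp (1 + 1 / (4 * b)) := by
    rw [← Real.exp_add]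
    apply Real.exp_le_exp.2
    have : 1 / (4 * b) - (r - b * r ^ 2) = (1 - 2 * b * r) ^ 2 / (4 * b) := by field_simp; ring
    have : 0 ≤ (1 - 2 * b * r) ^ 2 / (4 * b) := by positivity
    linarith
  calc r ^ k * ‖iteratedFDeriv ℝ n (Real.exp ∘ fun y : E => -b * ‖y‖ ^ 2) x‖
      ≤ (1 + r) ^ k * (n.factorial * Real.exp (-b * r ^ 2) * ((C + 1) * (1 + r) ^ m) ^ n) := by
        gcongr; linarith
    _ = n.factorial * (C + 1) ^ n * ((1 + r) ^ (k + m * n) * Real.exp (-b * r ^ 2)) := by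
        rw [mul_pow, ← pow_mul, pow_add]; ring
    _ ≤ n.factorial * (C + 1) ^ n *
        ((k + m * n).factorial * Real.exp (1 + r) * Real.exp (-b * r ^ 2)) := by gcongr
    _ ≤ _ := by
        rw [mul_assoc ((k + m * n).factorial : ℝ)]
        gcongr

/-- The Gaussian `y ↦ exp (-b ‖y‖²)`, `b > 0`, as a Schwartz function. -/
def gaussianSchwartz (n : ℕ) (b : ℝ) (hb : 0 < b) : 𝓢(EuclideanSpace ℝ (Fin n), ℝ) where
  toFun y := Real.exp (-b * ‖y‖ ^ 2)
  smooth' := Real.contDiff_exp.comp (contDiff_const.mul (contDiff_norm_sq ℝ))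
  decay' := gaussian_decay hb

/-- The heat kernel `h_t(y) = (4 π t) ^ (-n / 2) exp (-‖y‖² / (4 t))`, as a Schwartz function. -/
def heatKernel (n : ℕ) (t : ℝ) (ht : 0 < t) : 𝓢(EuclideanSpace ℝ (Fin n), ℂ) :=
  SchwartzMap.postcompCLM Complex.ofRealCLM
    ((4 * Real.pi * t) ^ (-(n : ℝ) / 2) • gaussianSchwartz n (1 / (4 * t)) (by positivity))

theorem heatKernel_apply (n : ℕ) (t : ℝ) (ht : 0 < t) (y : EuclideanSpace ℝ (Fin n)) :
    heatKernel n t ht y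
      = (((4 * Real.pi * t) ^ (-(n : ℝ) / 2) * Real.exp (-‖y‖ ^ 2 / (4 * t)) : ℝ) : ℂ) := by
  have h : -(1 / (4 * t)) * ‖y‖ ^ 2 = -‖y‖ ^ 2 / (4 * t) := by ring
  rw [← h]
  rfl

/-- The heat extension `(h_t * T)(x) = T (h_t(x - ·))` of a tempered distribution `T`; note that
`h_t(x - y) = h_t(y - x)`. It is a smooth function of `x`. -/
def heatExtension {n : ℕ} (T : 𝓢'(EuclideanSpace ℝ (Fin n), ℂ)) (t : ℝ) (ht : 0 < t)
    (x : EuclideanSpace ℝ (Fin n)) : ℂ :=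
  T ((heatKernel n t ht).compSubConstCLM ℝ x)

/-- The thermic norm `sup_{t > 0} t ^ (β / 2) ‖h_t * T‖_∞` of the homogeneous Besov space of
indices `(-β, ∞, ∞)`. As `h_t * T` is continuous, its `L^∞` norm is its supremum. -/
def besovNorm {n : ℕ} (β : ℝ) (T : 𝓢'(EuclideanSpace ℝ (Fin n), ℂ)) : ℝ≥0∞ :=
  ⨆ (t : ℝ) (ht : 0 < t), ENNReal.ofReal (t ^ (β / 2)) * ⨆ x, ‖heatExtension T t ht x‖ₑ

/-- Membership of the homogeneous Besov space of indices `(-β, ∞, ∞)`. -/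
def MemBesov {n : ℕ} (β : ℝ) (T : 𝓢'(EuclideanSpace ℝ (Fin n), ℂ)) : Prop :=
  besovNorm β T < ⊤

/-! ## Fractional powers of the Laplacian on tempered distributions -/

/-- `T` has no component at frequency `0` (in particular no polynomial part): its frequency
truncations to the balls of radius `O(1 / R)` tend to `0` in the space of tempered distributions
as `R → ∞`. -/
def VanishesAtZeroFrequency {n : ℕ} (T : 𝓢'(EuclideanSpace ℝ (Fin n), ℂ)) : Prop :=
  ∀ χ : EuclideanSpace ℝ (Fin n) → ℂ, ContDiff ℝ ∞ χ → HasCompactSupport χ →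
    Tendsto (fun R : ℝ => TemperedDistribution.fourierMultiplierCLM ℂ (fun ξ => χ (R • ξ)) T)
      atTop (𝓝 0)

/-- `G = (-Δ)^{s/2} T`: the Fourier transform of `G` is that of `T` times the symbol of
`(-Δ)^{s/2}`, which is `(2π‖ξ‖)^s` for Mathlib's normalization
`𝓕 φ ξ = ∫ exp (-2πi⟨x, ξ⟩) φ x` of the Fourier transform.

The symbol need not be smooth at `0`, so the product is tested against the Schwartz functions `φ`
supported away from `0`, for which `ψ = (2π‖·‖)^s φ` is again a Schwartz function. This determines
`𝓕 G` away from `0`, that is, `G` up to a polynomial, and the polynomial is fixed by the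
condition `VanishesAtZeroFrequency`. So there is at most one such `G`. -/
structure IsFracLaplacian {n : ℕ} (s : ℝ) (T G : 𝓢'(EuclideanSpace ℝ (Fin n), ℂ)) : Prop where
  fourier_eq : ∀ φ ψ : 𝓢(EuclideanSpace ℝ (Fin n), ℂ), (0 : EuclideanSpace ℝ (Fin n)) ∉ tsupport φ →
    (∀ ξ, ψ ξ = (((2 * Real.pi * ‖ξ‖) ^ s : ℝ) : ℂ) * φ ξ) → 𝓕 G φ = 𝓕 T ψ
  vanishes : VanishesAtZeroFrequency G

/-- The tempered distribution `G` is the function `g`. -/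
def IsGivenBy {n : ℕ} (G : 𝓢'(EuclideanSpace ℝ (Fin n), ℂ)) (g : EuclideanSpace ℝ (Fin n) → ℂ) :
    Prop :=
  ∀ φ : 𝓢(EuclideanSpace ℝ (Fin n), ℂ),
    Integrable (fun x => φ x * g x) volume ∧ G φ = ∫ x, φ x * g x

end

/-!
# A Gagliardo–Nirenberg inequality with an Orlicz and a negative Besov endpoint

Let `F = (-Δ)^{s/2} f` be a function `g` of the Orlicz space of `A`, and let `b` bound the thermic
norm of `f`. Cut the frequency space into the dyadic annuli `‖ξ‖ ∼ 2 ^ j` and let `u j` be the part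
of `(-Δ)^{s₁/2} f` at frequencies `∼ 2 ^ j`, a smooth function (`freqBand`). It is bounded in two
ways.

* Its kernel is the convolution of an integrable kernel with the heat kernel at time `4 ^ (-j)`, so
  `|u j x| ≲ 2 ^ (j (s₁ + β)) b` (`exists_norm_freqBand_le_besovNorm`).
* It is also the part of `(-Δ)^{(s₁ - s)/2} F` at those frequencies, so it is an average of `g` at
  scale `2 ^ (-j)`, and `|u j x| ≲ 2 ^ (-j (s - s₁)) M g x`, where `M` is the Hardy–Littlewood
  maximal operator (`exists_enorm_freqBand_le_maximalFun`).

Summing the smaller of the two bounds over `j`, as in Hedberg's inequality, gives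
`∑ j, |u j x| ≲ (M g x) ^ (1 - θ) b ^ θ` (`exists_tsum_enorm_freqBand_le`). For `A ∈ ∇₂` the
operator `M` is bounded on the Orlicz space (`exists_lintegral_maximalFun_div_le_one`), and the norm
inequality for `g₁ = ∑ j, u j` follows, because the rescaling of `A` undoes the power `1 - θ`.

It remains to identify `g₁` with `(-Δ)^{s₁/2} f`. A nonzero Young function grows at least linearly,
so `∑ j, |u j|` is at most a constant plus an integrable function and the series converges in the
sense of tempered distributions (`exists_isGivenBy_tsum`). Its Fourier transform away from the
origin is the right one because the dyadic cutoffs form a partition of unity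
(`fourier_eq_of_hasSum_freqBand`). It has no component at the zero frequency, because the truncation
to frequencies `O (1 / R)` only meets the bands with `2 ^ j = O (1 / R)`, whose suprema have a sum
tending to zero (`vanishesAtZeroFrequency_of_hasSum_freqBand`).

The manipulation of the bands of a tempered distribution `T` rests on the identity
`T (φ * h) = ∫ φ z T (h (· - z)) dz` for Schwartz functions (`TemperedDistribution.apply_conv`).
-/

noncomputable section

/-! ### Two-sided geometric sums -/

theorem ENNReal.tsum_int_eq_add (f : ℤ → ℝ≥0∞) (J : ℤ) :
    ∑' j, f j = ∑' i : ℕ, f (J + 1 + i) + ∑' i : ℕ, f (J - i) := by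
  rw [← (Equiv.addLeft (J + 1)).tsum_eq f,
    tsum_of_nat_of_neg_add_one ENNReal.summable ENNReal.summable]
  congr 1
  refine tsum_congr fun i => ?_
  simp only [Equiv.coe_addLeft]
  congr 1
  ring

/-- A series over `ℤ` with geometric decay on both sides of the index `J`. -/
theorem ENNReal.tsum_int_le_of_geometric {f : ℤ → ℝ≥0∞} (J : ℤ) {a c r₁ r₂ : ℝ≥0∞}
    (h₁ : ∀ i : ℕ, f (J - i) ≤ a * r₁ ^ i) (h₂ : ∀ i : ℕ, f (J + 1 + i) ≤ c * r₂ ^ i) :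
    ∑' j, f j ≤ c * (1 - r₂)⁻¹ + a * (1 - r₁)⁻¹ := by
  rw [ENNReal.tsum_int_eq_add f J, ← ENNReal.tsum_geometric, ← ENNReal.tsum_geometric,
    ← ENNReal.tsum_mul_left, ← ENNReal.tsum_mul_left]
  exact add_le_add (ENNReal.tsum_le_tsum h₂) (ENNReal.tsum_le_tsum h₁)

/-! ### Young functions -/

section Young

variable {A : ℝ≥0 → ℝ≥0}

theorem intervalIntegrable_coe_toNNReal {a : ℝ≥0 → ℝ≥0} (ha : Monotone a) (x y : ℝ) :
    IntervalIntegrable (fun σ : ℝ => (a σ.toNNReal : ℝ)) volume x y :=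
  Monotone.intervalIntegrable fun _ _ h => NNReal.coe_le_coe.2 (ha (Real.toNNReal_mono h))

theorem IsYoungFunction.monotone (hA : IsYoungFunction A) : Monotone A := by
  obtain ⟨a, ha, -, -, hAa⟩ := hA
  intro s t hst
  rw [← NNReal.coe_le_coe, hAa, hAa, ← sub_nonneg,
    intervalIntegral.integral_interval_sub_left (intervalIntegrable_coe_toNNReal ha _ _)
      (intervalIntegrable_coe_toNNReal ha _ _)]
  exact intervalIntegral.integral_nonneg (NNReal.coe_le_coe.2 hst) fun _ _ => NNReal.coe_nonneg _

theorem IsYoungFunction.map_mul_le (hA : IsYoungFunction A) {ε : ℝ≥0} (hε : ε ≤ 1) (t : ℝ≥0) :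
    A (ε * t) ≤ ε * A t := by
  obtain ⟨a, ha, -, -, hAa⟩ := hA
  rw [← NNReal.coe_le_coe, NNReal.coe_mul, hAa, hAa]
  have h := intervalIntegral.mul_integral_comp_mul_left (a := 0) (b := t)
    (f := fun σ : ℝ => (a σ.toNNReal : ℝ)) (ε : ℝ)
  simp only [mul_zero] at h
  rw [NNReal.coe_mul, ← h]
  refine mul_le_mul_of_nonneg_left ?_ ε.2
  refine intervalIntegral.integral_mono_on t.2 ?_ (intervalIntegrable_coe_toNNReal ha _ _) ?_
  · refine Monotone.intervalIntegrable fun x y h => NNReal.coe_le_coe.2 (ha (Real.toNNReal_mono ?_))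
    exact mul_le_mul_of_nonneg_left h ε.2
  · intro x hx
    exact NNReal.coe_le_coe.2 (ha (Real.toNNReal_mono
      (mul_le_of_le_one_left hx.1 (NNReal.coe_le_one.2 hε))))

theorem IsYoungFunction.map_zero (hA : IsYoungFunction A) : A 0 = 0 := by
  simpa using hA.map_mul_le (ε := 0) zero_le_one 0

/-- A nonzero Young function grows at least linearly, so that its Orlicz space is contained in
`L¹ + L^∞`. -/
theorem IsYoungFunction.exists_le_add_mul (hA : IsYoungFunction A) (hA0 : ∃ t, A t ≠ 0) :
    ∃ t₀ c : ℝ≥0, ∀ t, t ≤ t₀ + c * A t := by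
  obtain ⟨t₁, ht₁⟩ := hA0
  refine ⟨t₁, t₁ / A t₁, fun t => ?_⟩
  rcases le_total t t₁ with h | h
  · exact h.trans le_self_add
  · have ht₁0 : t₁ ≠ 0 := by rintro rfl; exact ht₁ hA.map_zero
    have ht : t ≠ 0 := fun h0 => ht₁0 (le_antisymm (h0 ▸ h) zero_le)
    have := hA.map_mul_le (ε := t₁ / t) (div_le_one_of_le₀ h zero_le) t
    rw [div_mul_cancel₀ _ ht] at this
    refine le_trans ?_ le_add_self
    calc t = t / A t₁ * A t₁ := by field_simp
      _ ≤ t / A t₁ * (t₁ / t * A t) := by gcongr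
      _ = t₁ / A t₁ * A t := by field_simp

/-- Iterating `∇₂`: along the powers of its constant `C`, the function `A` decays like a power of
exponent greater than one. -/
theorem Nabla2.exists_iterate (h2 : Nabla2 A) :
    ∃ C : ℝ≥0, 1 < C ∧ ∀ (i : ℕ) (K : ℤ), A (C ^ (K - i)) ≤ (1 / (2 * C)) ^ i * A (C ^ K) := by
  obtain ⟨C, hC, h⟩ := h2
  have hC0 : C ≠ 0 := (zero_lt_one.trans hC).ne'
  refine ⟨C, hC, fun i K => ?_⟩
  induction i with
  | zero => simp
  | succ i ih =>
    refine (h _).trans ?_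
    rw [pow_succ', mul_assoc]
    gcongr
    convert ih using 2
    rw [← zpow_one_add₀ hC0]
    congr 1
    push_cast
    ring

end Young

/-! ### The Hardy–Littlewood maximal function -/

section Maximal

variable {E : Type*} [NormedAddCommGroup E] [InnerProductSpace ℝ E] [FiniteDimensional ℝ E]
  [MeasurableSpace E] [BorelSpace E]

/-- The centred Hardy–Littlewood maximal function of a nonnegative function: the supremum of its
means over the closed balls around `x`. -/
def maximalFun (q : E → ℝ≥0∞) (x : E) : ℝ≥0∞ :=
  ⨆ (r : ℝ) (_ : 0 < r), (∫⁻ y in Metric.closedBall x r, q y) / volume (Metric.closedBall x r)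

theorem volume_closedBall_ne_zero (x : E) {r : ℝ} (hr : 0 < r) :
    volume (Metric.closedBall x r) ≠ 0 :=
  (Metric.measure_closedBall_pos volume x hr).ne'

theorem volume_closedBall_ne_top (x : E) (r : ℝ) : volume (Metric.closedBall x r) ≠ ⊤ :=
  (isCompact_closedBall x r).measure_lt_top.ne

theorem setLIntegral_closedBall_le (q : E → ℝ≥0∞) (x : E) {r : ℝ} (hr : 0 < r) :
    ∫⁻ y in Metric.closedBall x r, q y ≤ volume (Metric.closedBall x r) * maximalFun q x := by
  rw [mul_comm, ← ENNReal.div_le_iff (volume_closedBall_ne_zero x hr)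
    (volume_closedBall_ne_top x r)]
  exact le_iSup₂_of_le r hr le_rfl

theorem maximalFun_mono {q q' : E → ℝ≥0∞} (h : ∀ y, q y ≤ q' y) (x : E) :
    maximalFun q x ≤ maximalFun q' x :=
  iSup₂_mono fun _ _ => ENNReal.div_le_div_right (lintegral_mono h) _

theorem maximalFun_add_const_le (q : E → ℝ≥0∞) (c : ℝ≥0∞) (x : E) :
    maximalFun (fun y => q y + c) x ≤ maximalFun q x + c := by
  refine iSup₂_le fun r hr => ?_
  rw [lintegral_add_right _ measurable_const, ENNReal.add_div, setLIntegral_const,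
    ENNReal.mul_div_cancel_right (volume_closedBall_ne_zero x hr) (volume_closedBall_ne_top x r)]
  have h : (∫⁻ y in Metric.closedBall x r, q y) / volume (Metric.closedBall x r)
      ≤ maximalFun q x := le_iSup₂_of_le r hr le_rfl
  gcongr

theorem maximalFun_const_mul (q : E → ℝ≥0∞) {c : ℝ≥0∞} (hc : c ≠ ⊤) (x : E) :
    maximalFun (fun y => c * q y) x = c * maximalFun q x := by
  simp only [maximalFun, ENNReal.mul_iSup, div_eq_mul_inv, mul_assoc, lintegral_const_mul' _ _ hc]

/-- The weak `(1, 1)` inequality, from the Vitali covering lemma. -/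
theorem volume_lt_maximalFun_le [Nontrivial E] (q : E → ℝ≥0∞) {l : ℝ≥0∞} (hl : l ≠ 0)
    (hl' : l ≠ ⊤) :
    volume {x | l < maximalFun q x} ≤ 5 ^ Module.finrank ℝ E * (l⁻¹ * ∫⁻ y, q y) := by
  set d := Module.finrank ℝ E with hd
  have hd0 : d ≠ 0 := Module.finrank_pos.ne'
  by_cases hI : ∫⁻ y, q y = ⊤
  · rw [hI, ENNReal.mul_top (ENNReal.inv_ne_zero.2 hl'), ENNReal.mul_top (by positivity)]
    exact le_top
  set S := {x | l < maximalFun q x}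
  have hS : ∀ x, ∃ r : ℝ, x ∈ S → 0 < r ∧
      l * volume (Metric.closedBall x r) < ∫⁻ y in Metric.closedBall x r, q y := by
    intro x
    by_cases hx : x ∈ S
    · obtain ⟨r, hr⟩ := lt_iSup_iff.1 (show l < maximalFun q x from hx)
      obtain ⟨hr0, hr⟩ := lt_iSup_iff.1 hr
      exact ⟨r, fun _ => ⟨hr0, (ENNReal.lt_div_iff_mul_lt (Or.inl (volume_closedBall_ne_zero x hr0))
        (Or.inl (volume_closedBall_ne_top x r))).1 hr⟩⟩
    · exact ⟨0, fun h => absurd h hx⟩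
  choose r hr using hS
  set v := volume (Metric.ball (0 : E) 1) with hv
  have hv0 : v ≠ 0 := (Metric.measure_ball_pos volume 0 one_pos).ne'
  have hvt : v ≠ ⊤ := measure_ball_lt_top.ne
  have hvol : ∀ (x : E) {ρ : ℝ}, 0 ≤ ρ →
      volume (Metric.closedBall x ρ) = ENNReal.ofReal (ρ ^ d) * v := fun x ρ hρ =>
    Measure.addHaar_closedBall volume x hρ
  -- the radii are bounded, as the mass of `q` is finite
  have hR : ∀ x ∈ S, r x ≤ max 1 ((∫⁻ y, q y) / (l * v)).toReal := by
    intro x hx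
    obtain ⟨h0, h⟩ := hr x hx
    rcases le_total (r x) 1 with h1 | h1
    · exact h1.trans (le_max_left _ _)
    · refine le_max_of_le_right ((le_self_pow₀ h1 hd0).trans ?_)
      have hlv : l * v ≠ 0 := mul_ne_zero hl hv0
      rw [← ENNReal.ofReal_le_iff_le_toReal (ENNReal.div_ne_top hI hlv),
        ENNReal.le_div_iff_mul_le (Or.inl hlv) (Or.inr hI)]
      calc ENNReal.ofReal (r x ^ d) * (l * v) = l * volume (Metric.closedBall x (r x)) := by
            rw [hvol x h0.le]; ring
        _ ≤ _ := h.le.trans (setLIntegral_le_lintegral _ _)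
  obtain ⟨u, huS, hdisj, hcov⟩ := Vitali.exists_disjoint_subfamily_covering_enlargement_closedBall
    S id r _ hR 5 (by norm_num)
  simp only [id] at hdisj hcov
  have hu : u.Countable := hdisj.countable_of_nonempty_interior fun x hx =>
    ⟨x, Metric.ball_subset_interior_closedBall (Metric.mem_ball_self (hr x (huS hx)).1)⟩
  calc volume S ≤ volume (⋃ x ∈ u, Metric.closedBall x (5 * r x)) := by
        refine measure_mono fun x hx => ?_
        obtain ⟨b, hb, hxb⟩ := hcov x hx
        exact Set.mem_biUnion hb (hxb (Metric.mem_closedBall_self (hr x hx).1.le))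
    _ ≤ ∑' x : u, volume (Metric.closedBall (x : E) (5 * r x)) := measure_biUnion_le _ hu _
    _ ≤ ∑' x : u, 5 ^ d * (l⁻¹ * ∫⁻ y in Metric.closedBall (x : E) (r x), q y) := by
        refine ENNReal.tsum_le_tsum fun x => ?_
        obtain ⟨h0, h⟩ := hr x (huS x.2)
        have h5 : volume (Metric.closedBall (x : E) (5 * r x))
            = 5 ^ d * volume (Metric.closedBall (x : E) (r x)) := by
          rw [hvol _ (by positivity), hvol _ h0.le, mul_pow, ENNReal.ofReal_mul (by positivity),
            ENNReal.ofReal_pow (by norm_num)]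
          norm_num [mul_assoc]
        rw [h5]
        gcongr
        rw [mul_comm, ← div_eq_mul_inv, ENNReal.le_div_iff_mul_le (Or.inl hl) (Or.inl hl'),
          mul_comm]
        exact h.le
    _ = 5 ^ d * (l⁻¹ * ∫⁻ y in ⋃ x ∈ u, Metric.closedBall x (r x), q y) := by
        rw [ENNReal.tsum_mul_left, ENNReal.tsum_mul_left,
          lintegral_biUnion hu (fun _ _ => measurableSet_closedBall) hdisj]
    _ ≤ _ := by gcongr; exact Measure.restrict_le_self

/-- The weak `(1, 1)` inequality after removal of the part of `q` below half the level. -/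
theorem volume_lt_maximalFun_le_indicator [Nontrivial E] (q : E → ℝ≥0∞) {l : ℝ≥0∞} (hl : l ≠ 0)
    (hl' : l ≠ ⊤) :
    volume {x | l < maximalFun q x}
      ≤ 5 ^ Module.finrank ℝ E * (2 * (l⁻¹ * ∫⁻ y, {y | l < 2 * q y}.indicator q y)) := by
  have hsub : {x | l < maximalFun q x} ⊆
      {x | l / 2 < maximalFun ({y | l < 2 * q y}.indicator q) x} := by
    intro x hx
    by_contra hx'
    simp only [Set.mem_ofPred_eq, not_lt] at hx hx'
    refine hx.not_ge ?_
    calc maximalFun q x ≤ maximalFun (fun y => {y | l < 2 * q y}.indicator q y + l / 2) x := by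
          refine maximalFun_mono (fun y => ?_) x
          by_cases hy : l < 2 * q y
          · rw [Set.indicator_of_mem (by exact hy)]; exact le_self_add
          · refine le_trans ?_ le_add_self
            rw [ENNReal.le_div_iff_mul_le (by simp) (by simp), mul_comm]
            exact not_lt.1 hy
      _ ≤ l / 2 + l / 2 := (maximalFun_add_const_le _ _ _).trans (add_le_add_left hx' _)
      _ = l := ENNReal.add_halves l
  refine (measure_mono hsub).trans ((volume_lt_maximalFun_le _ (by simp [hl])
    (ENNReal.div_ne_top hl' (by simp))).trans_eq ?_)
  rw [ENNReal.inv_div (by simp) (by simp), div_eq_mul_inv, mul_assoc 2]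

/-- The maximal function of an integrable function is finite almost everywhere, by the weak
`(1, 1)` inequality at levels `k → ∞`. -/
theorem maximalFun_lt_top_ae [Nontrivial E] {q : E → ℝ≥0∞} (hq : ∫⁻ y, q y ≠ ⊤) :
    ∀ᵐ x, maximalFun q x < ⊤ := by
  have h : ∀ k : ℕ, k ≠ 0 → volume {x | ¬ maximalFun q x < ⊤}
      ≤ 5 ^ Module.finrank ℝ E * (((k : ℝ≥0∞))⁻¹ * ∫⁻ y, q y) := fun k hk =>
    (measure_mono fun x hx => by
      simp only [Set.mem_ofPred_eq, not_lt, top_le_iff] at hx ⊢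
      rw [hx]; exact ENNReal.natCast_lt_top k).trans
    (volume_lt_maximalFun_le q (Nat.cast_ne_zero.2 hk) (ENNReal.natCast_ne_top k))
  have hlim : Tendsto (fun k : ℕ => 5 ^ Module.finrank ℝ E * (((k : ℝ≥0∞))⁻¹ * ∫⁻ y, q y)) atTop
      (𝓝 (5 ^ Module.finrank ℝ E * (0 * ∫⁻ y, q y))) :=
    ENNReal.Tendsto.const_mul (ENNReal.Tendsto.mul_const ENNReal.tendsto_inv_nat_nhds_zero
      (Or.inr hq)) (Or.inr (by finiteness))
  rw [zero_mul, mul_zero] at hlim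
  exact le_antisymm (ge_of_tendsto hlim (eventually_atTop.2 ⟨1, fun k hk => h k (by omega)⟩))
    zero_le

end Maximal

/-! ### The maximal inequality in Orlicz spaces -/

section Modular

variable {E : Type*} [NormedAddCommGroup E] [InnerProductSpace ℝ E] [FiniteDimensional ℝ E]
  [MeasurableSpace E] [BorelSpace E] {A : ℝ≥0 → ℝ≥0}

/-- The pointwise form of `∇₂` behind the modular inequality: a sum over the powers of `C`
that stands for `t ∫₀^{2t} a(λ) / λ dλ ≲ A(2 C t)`. -/
theorem tsum_zpow_indicator_le (hmono : Monotone A) {C : ℝ≥0} (hC : 1 < C)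
    (hit : ∀ (i : ℕ) (K : ℤ), A (C ^ (K - i)) ≤ (1 / (2 * C)) ^ i * A (C ^ K)) (t : ℝ≥0) :
    ∑' k : ℤ, (if C ^ k < 2 * t then ((A (C ^ (k + 1)) * (C ^ k)⁻¹ * t : ℝ≥0) : ℝ≥0∞) else 0)
      ≤ 2 * C * A (2 * C * t) := by
  have hC0 : C ≠ 0 := (zero_lt_one.trans hC).ne'
  rcases eq_or_ne t 0 with rfl | ht
  · simp
  have ht2 : 0 < 2 * t := by positivity
  obtain ⟨K, hK1, hK2⟩ := exists_mem_Ioc_zpow ht2 hC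
  refine (ENNReal.tsum_int_le_of_geometric K (a := C * A (2 * C * t)) (r₁ := 2⁻¹) (c := 0) (r₂ := 0)
    (fun i => ?_) (fun i => ?_)).trans_eq ?_
  · have hlt : C ^ (K - i) < 2 * t :=
      (zpow_le_zpow_right₀ hC.le (by omega)).trans_lt hK1
    rw [if_pos hlt]
    have key : A (C ^ (K - i + 1)) * (C ^ (K - i))⁻¹ * t ≤ C * A (2 * C * t) * 2⁻¹ ^ i := by
      have h1 : A (C ^ (K - i + 1)) ≤ (1 / (2 * C)) ^ i * A (2 * C * t) := by
        rw [show K - i + 1 = (K + 1) - i by ring]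
        refine (hit i (K + 1)).trans ?_
        gcongr
        apply hmono
        rw [zpow_add_one₀ hC0]
        calc C ^ K * C ≤ 2 * t * C := by gcongr
          _ = _ := by ring
      have h2 : t ≤ C ^ K * C := by
        rw [← zpow_add_one₀ hC0]
        exact le_trans (le_mul_of_one_le_left zero_le one_le_two) hK2
      calc A (C ^ (K - i + 1)) * (C ^ (K - i))⁻¹ * t
          ≤ (1 / (2 * C)) ^ i * A (2 * C * t) * (C ^ (K - i))⁻¹ * (C ^ K * C) := by gcongr
        _ = C * A (2 * C * t) * 2⁻¹ ^ i := by
          rw [zpow_sub₀ hC0, zpow_natCast, one_div, mul_inv, mul_pow, inv_pow C]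
          have : C ^ K ≠ 0 := zpow_ne_zero _ hC0
          field_simp
    calc ((A (C ^ (K - i + 1)) * (C ^ (K - i))⁻¹ * t : ℝ≥0) : ℝ≥0∞)
        ≤ ((C * A (2 * C * t) * 2⁻¹ ^ i : ℝ≥0) : ℝ≥0∞) := ENNReal.coe_le_coe.2 key
      _ = _ := by push_cast [ENNReal.coe_inv]; rfl
  · rw [if_neg, zero_mul]
    rw [not_lt]
    exact hK2.trans (zpow_le_zpow_right₀ hC.le (by omega))
  · rw [zero_mul, zero_add, ENNReal.one_sub_inv_two, inv_inv]
    ring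

/-- The modular inequality for the maximal function, under `∇₂`: the weak `(1, 1)` inequality is
summed over the levels `C ^ k`. -/
theorem exists_lintegral_comp_maximalFun_le [Nontrivial E] (hmono : Monotone A) (h0 : A 0 = 0)
    (h2 : Nabla2 A) :
    ∃ C K : ℝ≥0, ∀ q : E → ℝ≥0, Measurable q →
      ∫⁻ x, (A (maximalFun (fun y => (q y : ℝ≥0∞)) x).toNNReal : ℝ≥0∞)
        ≤ K * ∫⁻ x, (A (C * q x) : ℝ≥0∞) := by
  obtain ⟨C, hC, hit⟩ := h2.exists_iterate
  have hC0 : C ≠ 0 := (zero_lt_one.trans hC).ne'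
  set d := Module.finrank ℝ E
  refine ⟨2 * C, 5 ^ d * 2 * (2 * C), fun q hq => ?_⟩
  set M := maximalFun (fun y => (q y : ℝ≥0∞))
  -- measurable hulls of the level sets make the measurability of `M` irrelevant
  set S : ℤ → Set E := fun k => toMeasurable volume {x | ((C ^ k : ℝ≥0) : ℝ≥0∞) < M x}
  have hpt : ∀ x, (A (M x).toNNReal : ℝ≥0∞)
      ≤ ∑' k : ℤ, (S k).indicator (fun _ => (A (C ^ (k + 1)) : ℝ≥0∞)) x := by
    intro x
    rcases eq_or_ne (M x).toNNReal 0 with h | h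
    · simp [h, h0]
    · obtain ⟨k, hk1, hk2⟩ := exists_mem_Ioc_zpow (pos_iff_ne_zero.2 h) hC
      have hx : x ∈ S k := subset_toMeasurable _ _
        (show ((C ^ k : ℝ≥0) : ℝ≥0∞) < M x from (ENNReal.coe_lt_coe.2 hk1).trans_le
          ENNReal.coe_toNNReal_le_self)
      refine le_trans ?_ (ENNReal.le_tsum k)
      rw [Set.indicator_of_mem hx]
      exact ENNReal.coe_le_coe.2 (hmono hk2)
  calc ∫⁻ x, (A (M x).toNNReal : ℝ≥0∞)
      ≤ ∫⁻ x, ∑' k : ℤ, (S k).indicator (fun _ => (A (C ^ (k + 1)) : ℝ≥0∞)) x := lintegral_mono hpt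
    _ = ∑' k : ℤ, (A (C ^ (k + 1)) : ℝ≥0∞) * volume {x | ((C ^ k : ℝ≥0) : ℝ≥0∞) < M x} := by
        rw [lintegral_tsum fun k => (measurable_const.indicator
          (measurableSet_toMeasurable _ _)).aemeasurable]
        refine tsum_congr fun k => ?_
        rw [lintegral_indicator_const (measurableSet_toMeasurable _ _), measure_toMeasurable]
    _ ≤ ∑' k : ℤ, 5 ^ d * 2 * ∫⁻ y,
          (if C ^ k < 2 * q y then ((A (C ^ (k + 1)) * (C ^ k)⁻¹ * q y : ℝ≥0) : ℝ≥0∞) else 0) := by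
        refine ENNReal.tsum_le_tsum fun k => ?_
        have hk : C ^ k ≠ 0 := zpow_ne_zero _ hC0
        refine (mul_le_mul_right (volume_lt_maximalFun_le_indicator _ (ENNReal.coe_ne_zero.2 hk)
          ENNReal.coe_ne_top) _).trans_eq ?_
        rw [← ENNReal.coe_inv hk]
        have : ∀ a b c e f : ℝ≥0∞, a * (b * (c * (e * f))) = b * c * ((a * e) * f) := by
          intros; ring
        rw [this, ← ENNReal.coe_mul, ← lintegral_const_mul' _ _ ENNReal.coe_ne_top]
        congr 2
        ext y
        by_cases hy : C ^ k < 2 * q y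
        · rw [if_pos hy, Set.indicator_of_mem (by exact_mod_cast hy)]
          push_cast; rfl
        · rw [if_neg hy, Set.indicator_of_notMem (by exact_mod_cast hy), mul_zero]
    _ = 5 ^ d * 2 * ∫⁻ y, ∑' k : ℤ,
          (if C ^ k < 2 * q y then ((A (C ^ (k + 1)) * (C ^ k)⁻¹ * q y : ℝ≥0) : ℝ≥0∞) else 0) := by
        rw [ENNReal.tsum_mul_left, lintegral_tsum fun k => ?_]
        refine (Measurable.ite (measurableSet_lt measurable_const (hq.const_mul 2)) ?_
          measurable_const).aemeasurable
        exact (hq.const_mul _).coe_nnreal_ennreal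
    _ ≤ 5 ^ d * 2 * ∫⁻ y, 2 * C * (A (2 * C * q y) : ℝ≥0∞) := by
        gcongr with y
        exact tsum_zpow_indicator_le hmono hC hit (q y)
    _ = _ := by
        rw [lintegral_const_mul' _ _ (by finiteness)]
        push_cast
        ring

/-- The maximal function is bounded on the Orlicz space of a Young function in `∇₂`; the bound is
stated for the unit ball of the Luxemburg functional. -/
theorem exists_lintegral_maximalFun_div_le_one [Nontrivial E] (hA : IsYoungFunction A)
    (hA0 : ∃ t, A t ≠ 0) (h2 : Nabla2 A) :
    ∃ K : ℝ≥0, 0 < K ∧ ∀ q : E → ℝ≥0, Measurable q → ∫⁻ x, (A (q x) : ℝ≥0∞) ≤ 1 →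
      (∀ᵐ x, maximalFun (fun y => (q y : ℝ≥0∞)) x < ⊤) ∧
      ∫⁻ x, (A ((maximalFun (fun y => (q y : ℝ≥0∞)) x).toNNReal / K) : ℝ≥0∞) ≤ 1 := by
  obtain ⟨C, K, hCK⟩ := exists_lintegral_comp_maximalFun_le (E := E) hA.monotone hA.map_zero h2
  obtain ⟨t₀, c, htc⟩ := hA.exists_le_add_mul hA0
  set C' := max C 1
  set K' := max K 1
  have hC' : C' ≠ 0 := (zero_lt_one.trans_le (le_max_right _ _)).ne'
  have hK' : K' ≠ 0 := (zero_lt_one.trans_le (le_max_right _ _)).ne'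
  refine ⟨C' * K', by positivity, fun q hq hq1 => ⟨?_, ?_⟩⟩
  · have hfin : ∫⁻ x, (A (q x) : ℝ≥0∞) ≠ ⊤ := (hq1.trans_lt ENNReal.one_lt_top).ne
    filter_upwards [maximalFun_lt_top_ae hfin] with x hx
    calc maximalFun (fun y => (q y : ℝ≥0∞)) x
        ≤ maximalFun (fun y => c * (A (q y) : ℝ≥0∞) + t₀) x := maximalFun_mono (fun y => by
          rw [add_comm]; exact_mod_cast htc (q y)) x
      _ ≤ c * maximalFun (fun y => (A (q y) : ℝ≥0∞)) x + t₀ := by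
          rw [← maximalFun_const_mul _ ENNReal.coe_ne_top]
          exact maximalFun_add_const_le _ _ _
      _ < ⊤ := ENNReal.add_lt_top.2 ⟨ENNReal.mul_lt_top ENNReal.coe_lt_top hx, ENNReal.coe_lt_top⟩
  -- the constant `C'` absorbs the dilation inside `A`, and `K'` the factor in front of the integral
  · have h := hCK (fun x => C'⁻¹ * q x) (hq.const_mul _)
    have hM : ∀ x, (maximalFun (fun y => ((C'⁻¹ * q y : ℝ≥0) : ℝ≥0∞)) x).toNNReal
        = C'⁻¹ * (maximalFun (fun y => (q y : ℝ≥0∞)) x).toNNReal := by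
      intro x
      simp only [ENNReal.coe_mul]
      rw [maximalFun_const_mul _ ENNReal.coe_ne_top, ENNReal.toNNReal_mul, ENNReal.toNNReal_coe]
    simp only [hM] at h
    calc ∫⁻ x, (A ((maximalFun (fun y => (q y : ℝ≥0∞)) x).toNNReal / (C' * K')) : ℝ≥0∞)
        ≤ ∫⁻ x, (K'⁻¹ : ℝ≥0) * (A (C'⁻¹ * (maximalFun (fun y => (q y : ℝ≥0∞)) x).toNNReal)
            : ℝ≥0∞) := by
          refine lintegral_mono fun x => ?_
          rw [← ENNReal.coe_mul, ENNReal.coe_le_coe]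
          refine le_trans (le_of_eq ?_) (hA.map_mul_le (inv_le_one_of_one_le₀ (le_max_right _ _)) _)
          congr 1
          rw [div_eq_mul_inv, mul_inv]
          ring
      _ = (K'⁻¹ : ℝ≥0) * ∫⁻ x, (A (C'⁻¹ * (maximalFun (fun y => (q y : ℝ≥0∞)) x).toNNReal)
            : ℝ≥0∞) := lintegral_const_mul' _ _ ENNReal.coe_ne_top
      _ ≤ (K'⁻¹ : ℝ≥0) * (K' * 1) := by
          gcongr
          refine h.trans ?_
          gcongr
          · exact le_max_left _ _
          · refine le_trans (lintegral_mono fun x => ?_) hq1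
            refine ENNReal.coe_le_coe.2 (hA.monotone ?_)
            rw [← mul_assoc]
            refine mul_le_of_le_one_left zero_le ?_
            rw [← div_eq_mul_inv]
            exact div_le_one_of_le₀ (le_max_left _ _) zero_le
      _ = 1 := by
          rw [mul_one, ← ENNReal.coe_mul, inv_mul_cancel₀ hK', ENNReal.coe_one]

/-- Integration against the dilates of an integrable kernel with a radially decreasing majorant is
controlled by the maximal function. -/
theorem exists_lintegral_kernel_mul_le_maximalFun {F : Type*} [NormedAddCommGroup F] {K : E → F}
    {C : ℝ} (hK : ∀ z, (1 + ‖z‖) ^ (Module.finrank ℝ E + 1) * ‖K z‖ ≤ C) :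
    ∃ C' : ℝ≥0, ∀ q : E → ℝ≥0∞, Measurable q → ∀ a : ℝ, 0 < a → ∀ x : E,
      ∫⁻ y, ENNReal.ofReal (a ^ Module.finrank ℝ E) * ‖K (a • (y - x))‖ₑ * q y
        ≤ C' * maximalFun q x := by
  set d := Module.finrank ℝ E with hd
  have hC : 0 ≤ C := le_trans (by positivity) (hK 0)
  set v := volume (Metric.ball (0 : E) 1) with hv
  have hvt : v ≠ ⊤ := measure_ball_lt_top.ne
  set B : ℕ → ℝ := fun i => C * 2 ^ (d + 1) / (2 ^ i) ^ (d + 1) with hB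
  -- a majorant of the kernel by multiples of indicators of dyadic balls
  have hdom : ∀ z, ‖K z‖ₑ ≤ ∑' i : ℕ, ENNReal.ofReal (B i) *
      (Metric.closedBall (0 : E) (2 ^ i)).indicator 1 z := by
    intro z
    have hex : ∃ i : ℕ, ‖z‖ ≤ 2 ^ i := (pow_unbounded_of_one_lt ‖z‖ one_lt_two).imp fun _ => le_of_lt
    classical
    have hi := Nat.find_spec hex
    refine le_trans ?_ (ENNReal.le_tsum (Nat.find hex))
    rw [Set.indicator_of_mem (by simpa using hi), Pi.one_apply, mul_one, ← ofReal_norm]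
    refine ENNReal.ofReal_le_ofReal ?_
    rw [le_div_iff₀ (by positivity), mul_comm]
    have h2 : (2 : ℝ) ^ Nat.find hex ≤ (1 + ‖z‖) * 2 := by
      rcases Nat.eq_zero_or_pos (Nat.find hex) with h | h
      · rw [h, pow_zero]; linarith [norm_nonneg z]
      · have := Nat.find_min hex (Nat.sub_lt h one_pos)
        rw [not_le] at this
        rw [← Nat.sub_add_cancel h, pow_succ, Nat.succ_eq_add_one, zero_add]
        linarith
    calc ((2 : ℝ) ^ Nat.find hex) ^ (d + 1) * ‖K z‖ ≤ ((1 + ‖z‖) * 2) ^ (d + 1) * ‖K z‖ := by gcongr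
      _ = (1 + ‖z‖) ^ (d + 1) * ‖K z‖ * 2 ^ (d + 1) := by rw [mul_pow]; ring
      _ ≤ C * 2 ^ (d + 1) := by gcongr; exact hK z
  refine ⟨(ENNReal.ofReal (C * 2 ^ (d + 1)) * v * 2).toNNReal, fun q hq a ha x => ?_⟩
  rw [ENNReal.coe_toNNReal (by finiteness)]
  have hball : ∀ (i : ℕ) (y : E), (Metric.closedBall (0 : E) (2 ^ i)).indicator
      (1 : E → ℝ≥0∞) (a • (y - x)) = (Metric.closedBall x (2 ^ i / a)).indicator 1 y := by
    intro i y
    simp only [Set.indicator, Metric.mem_closedBall, dist_eq_norm, le_div_iff₀' ha, sub_zero,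
      norm_smul, Real.norm_eq_abs, abs_of_pos ha, Pi.one_apply]
  have hmeas : ∀ i : ℕ, Measurable fun y : E => ENNReal.ofReal (a ^ d) * (ENNReal.ofReal (B i) *
      (Metric.closedBall x (2 ^ i / a)).indicator (1 : E → ℝ≥0∞) y) * q y := fun i =>
    (((measurable_one.indicator measurableSet_closedBall).const_mul _).const_mul _).mul hq
  have hmul : ∀ (s : Set E) (c c' : ℝ≥0∞) (y : E), c * (c' * s.indicator 1 y) * q y
      = c * c' * s.indicator q y := by
    intro s c c' y
    by_cases hy : y ∈ s <;> simp [hy, mul_assoc]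
  calc ∫⁻ y, ENNReal.ofReal (a ^ d) * ‖K (a • (y - x))‖ₑ * q y
      ≤ ∫⁻ y, ∑' i : ℕ, ENNReal.ofReal (a ^ d) * (ENNReal.ofReal (B i) *
          (Metric.closedBall x (2 ^ i / a)).indicator 1 y) * q y := by
        refine lintegral_mono fun y => ?_
        rw [ENNReal.tsum_mul_right, ENNReal.tsum_mul_left]
        gcongr
        simpa only [hball] using hdom (a • (y - x))
    _ ≤ ∑' i : ℕ, ENNReal.ofReal (C * 2 ^ (d + 1)) * v * maximalFun q x * 2⁻¹ ^ i := by
        rw [lintegral_tsum fun i => (hmeas i).aemeasurable]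
        refine ENNReal.tsum_le_tsum fun i => ?_
        have hi : 0 < (2 : ℝ) ^ i / a := by positivity
        simp only [hmul]
        rw [lintegral_const_mul' _ _ (by finiteness), lintegral_indicator measurableSet_closedBall]
        refine (mul_le_mul_right (setLIntegral_closedBall_le q x hi) _).trans_eq ?_
        rw [Measure.addHaar_closedBall volume x hi.le, ← ENNReal.ofReal_mul (by positivity),
          mul_assoc (ENNReal.ofReal _) (volume _), ← mul_assoc,
          ← ENNReal.ofReal_mul (by positivity)]
        have h2 : a ^ d * B i * (2 ^ i / a) ^ Module.finrank ℝ E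
            = C * 2 ^ (d + 1) * (2 ^ i)⁻¹ := by
          simp only [hB, ← hd, div_pow, pow_succ ((2 : ℝ) ^ i)]
          field_simp
        rw [h2, ENNReal.ofReal_mul (by positivity), ENNReal.ofReal_inv_of_pos (by positivity),
          ENNReal.ofReal_pow zero_le_two, ENNReal.ofReal_ofNat, ENNReal.inv_pow]
        ring
    _ = _ := by
        rw [ENNReal.tsum_mul_left, ENNReal.tsum_geometric, ENNReal.one_sub_inv_two, inv_inv]
        ring

end Modular

/-! ### Tempered distributions and superpositions of translates -/

section Interchange

open LineDeriv ContinuousLinearMap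

namespace SchwartzMap

theorem norm_pow_le_one_add_mul_one_add {E : Type*} [NormedAddCommGroup E] (x z : E) (k : ℕ) :
    ‖x‖ ^ k ≤ (1 + ‖z‖) ^ k * (1 + ‖x - z‖) ^ k := by
  rw [← mul_pow]
  refine pow_le_pow_left₀ (norm_nonneg _) ?_ _
  have := norm_le_norm_add_norm_sub' x z
  nlinarith [norm_nonneg z, norm_nonneg (x - z), mul_nonneg (norm_nonneg z) (norm_nonneg (x - z))]

section Translate

variable {E F : Type*} [NormedAddCommGroup E] [NormedSpace ℝ E] [NormedAddCommGroup F]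
  [NormedSpace ℝ F]

theorem exists_one_add_pow_mul_le (h : 𝓢(E, F)) (k l : ℕ) :
    ∃ B : ℝ, 0 ≤ B ∧ ∀ x, (1 + ‖x‖) ^ k * ‖iteratedFDeriv ℝ l h x‖ ≤ B :=
  ⟨_, by positivity, fun x =>
    one_add_le_sup_seminorm_apply (𝕜 := ℝ) (m := (k, l)) le_rfl le_rfl h x⟩

theorem iteratedFDeriv_compSubConstCLM (h : 𝓢(E, F)) (l : ℕ) (z x : E) :
    iteratedFDeriv ℝ l (h.compSubConstCLM ℝ z) x = iteratedFDeriv ℝ l h (x - z) :=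
  iteratedFDeriv_comp_sub l z x

theorem lineDerivOp_compSubConstCLM (h : 𝓢(E, F)) (m z : E) :
    ∂_{m} (h.compSubConstCLM ℝ z) = (∂_{m} h).compSubConstCLM ℝ z := by
  ext x
  rw [compSubConstCLM_apply, lineDerivOp_apply_eq_fderiv, lineDerivOp_apply_eq_fderiv]
  exact congrArg (· m) (fderiv_comp_sub (𝕜 := ℝ) (f := h) z)

theorem iteratedLineDerivOp_compSubConstCLM (h : 𝓢(E, F)) {l : ℕ} (m : Fin l → E) (z : E) :
    ∂^{m} (h.compSubConstCLM ℝ z) = (∂^{m} h).compSubConstCLM ℝ z := by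
  induction l with
  | zero => simp
  | succ l ih =>
    rw [iteratedLineDerivOp_succ_left, iteratedLineDerivOp_succ_left, ih,
      lineDerivOp_compSubConstCLM]

theorem exists_seminorm_compSubConstCLM_le (h : 𝓢(E, ℂ)) (k l : ℕ) :
    ∃ B : ℝ, 0 ≤ B ∧ ∀ z, SchwartzMap.seminorm ℂ k l (h.compSubConstCLM ℝ z)
      ≤ B * (1 + ‖z‖) ^ k := by
  obtain ⟨B, hB, h'⟩ := h.exists_one_add_pow_mul_le k l
  refine ⟨B, hB, fun z => seminorm_le_bound _ _ _ _ (by positivity) fun x => ?_⟩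
  rw [iteratedFDeriv_compSubConstCLM]
  calc ‖x‖ ^ k * ‖iteratedFDeriv ℝ l h (x - z)‖
      ≤ (1 + ‖z‖) ^ k * (1 + ‖x - z‖) ^ k * ‖iteratedFDeriv ℝ l h (x - z)‖ := by
        gcongr; exact norm_pow_le_one_add_mul_one_add x z k
    _ = (1 + ‖x - z‖) ^ k * ‖iteratedFDeriv ℝ l h (x - z)‖ * (1 + ‖z‖) ^ k := by ring
    _ ≤ _ := by gcongr; exact h' _

/-- Translation is strongly continuous on the Schwartz space. -/
theorem continuous_compSubConstCLM (h : 𝓢(E, ℂ)) :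
    Continuous fun z => h.compSubConstCLM ℝ z := by
  rw [continuous_iff_continuousAt]
  intro w
  refine ((schwartz_withSeminorms ℂ E ℂ).tendsto_nhds _ _).2 ?_
  rintro ⟨k, l⟩ ε hε
  obtain ⟨B, hB, hB'⟩ := h.exists_one_add_pow_mul_le k (l + 1)
  have key : ∀ z, ‖z - w‖ ≤ 1 → SchwartzMap.seminorm ℂ k l
      (h.compSubConstCLM ℝ z - h.compSubConstCLM ℝ w) ≤ (2 + ‖w‖) ^ k * B * ‖z - w‖ := by
    intro z hz
    refine seminorm_le_bound _ _ _ _ (by positivity) fun x => ?_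
    have hsub : iteratedFDeriv ℝ l (h.compSubConstCLM ℝ z - h.compSubConstCLM ℝ w) x
        = iteratedFDeriv ℝ l h (x - z) - iteratedFDeriv ℝ l h (x - w) := by
      rw [← iteratedFDeriv_compSubConstCLM, ← iteratedFDeriv_compSubConstCLM, FunLike.coe_sub]
      exact iteratedFDeriv_sub_apply ((smooth _ ⊤).contDiffAt.of_le (mod_cast le_top))
        ((smooth _ ⊤).contDiffAt.of_le (mod_cast le_top))
    rw [hsub]
    have hmv : ‖x‖ ^ k * ‖iteratedFDeriv ℝ l h (x - z) - iteratedFDeriv ℝ l h (x - w)‖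
        ≤ ((2 + ‖w‖) ^ k * B) * ‖(x - z) - (x - w)‖ := by
      rcases eq_or_lt_of_le (pow_nonneg (norm_nonneg x) k) with h0 | h0
      · rw [← h0, zero_mul]; positivity
      rw [mul_comm (‖x‖ ^ k), ← le_div_iff₀ h0, mul_div_right_comm]
      refine Convex.norm_image_sub_le_of_norm_fderiv_le (𝕜 := ℝ) (s := segment ℝ (x - w) (x - z))
        (fun y _ => ((h.smooth ⊤).differentiable_iteratedFDeriv
          (mod_cast ENat.natCast_lt_top l)) y) (fun y hy => ?_) (convex_segment _ _)
        (left_mem_segment _ _ _) (right_mem_segment _ _ _)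
      rw [norm_fderiv_iteratedFDeriv, le_div_iff₀ h0, mul_comm]
      obtain ⟨t, ht, rfl⟩ := (segment_eq_image' ℝ (x - w) (x - z)).subset hy
      set ζ := w + t • (z - w)
      have hy : x - w + t • (x - z - (x - w)) = x - ζ := by simp only [ζ]; module
      change ‖x‖ ^ k * ‖iteratedFDeriv ℝ (l + 1) h (x - w + t • (x - z - (x - w)))‖ ≤ _
      rw [hy]
      have hζ : 1 + ‖ζ‖ ≤ 2 + ‖w‖ := by
        have : ‖t • (z - w)‖ ≤ 1 := by
          rw [norm_smul, Real.norm_eq_abs, abs_of_nonneg ht.1]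
          exact mul_le_one₀ ht.2 (norm_nonneg _) hz
        linarith [norm_add_le w (t • (z - w))]
      calc ‖x‖ ^ k * ‖iteratedFDeriv ℝ (l + 1) h (x - ζ)‖
          ≤ (1 + ‖ζ‖) ^ k * (1 + ‖x - ζ‖) ^ k * ‖iteratedFDeriv ℝ (l + 1) h (x - ζ)‖ := by
            gcongr; exact norm_pow_le_one_add_mul_one_add x ζ k
        _ = (1 + ‖ζ‖) ^ k * ((1 + ‖x - ζ‖) ^ k * ‖iteratedFDeriv ℝ (l + 1) h (x - ζ)‖) := by ring
        _ ≤ (2 + ‖w‖) ^ k * B := by gcongr; exact hB' _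
    refine hmv.trans_eq ?_
    congr 1
    rw [show x - z - (x - w) = -(z - w) by abel, norm_neg]
  have hlim : Tendsto (fun z => (2 + ‖w‖) ^ k * B * ‖z - w‖) (𝓝 w) (𝓝 0) := by
    have : Continuous fun z => (2 + ‖w‖) ^ k * B * ‖z - w‖ := by fun_prop
    simpa using this.tendsto w
  filter_upwards [hlim.eventually (gt_mem_nhds hε), Metric.closedBall_mem_nhds w one_pos]
    with z hz hz1
  exact (key z (by simpa [dist_eq_norm] using hz1)).trans_lt hz

end Translate

section BoundedEmbedding

variable {E : Type*} [NormedAddCommGroup E] [NormedSpace ℝ E]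

/-- The space of values of the `l`-th derivative of a complex-valued function on `E`, seen as a
complex normed space only, so that its scalar action comes from the codomain `ℂ`. -/
def DerivSpace (E : Type*) [NormedAddCommGroup E] [NormedSpace ℝ E] (l : ℕ) : Type _ :=
  ContinuousMultilinearMap ℝ (fun _ : Fin l => E) ℂ

instance (l : ℕ) : NormedAddCommGroup (DerivSpace E l) :=
  inferInstanceAs (NormedAddCommGroup (ContinuousMultilinearMap ℝ (fun _ : Fin l => E) ℂ))

instance (l : ℕ) : NormedSpace ℂ (DerivSpace E l) :=
  inferInstanceAs (NormedSpace ℂ (ContinuousMultilinearMap ℝ (fun _ : Fin l => E) ℂ))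

instance (l : ℕ) : CompleteSpace (DerivSpace E l) :=
  inferInstanceAs (CompleteSpace (ContinuousMultilinearMap ℝ (fun _ : Fin l => E) ℂ))

/-- Evaluation of multilinear maps at a family of vectors. -/
def DerivSpace.evalCLM {l : ℕ} (m : Fin l → E) : DerivSpace E l →L[ℂ] ℂ :=
  LinearMap.mkContinuous
    { toFun := fun f : ContinuousMultilinearMap ℝ (fun _ : Fin l => E) ℂ => f m
      map_add' := fun _ _ => rfl
      map_smul' := fun _ _ => rfl }
    (∏ i, ‖m i‖) fun f => by
      rw [mul_comm]
      exact ContinuousMultilinearMap.le_opNorm f m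

/-- The `l`-th derivative of a Schwartz function, as a function with values in `DerivSpace E l`. -/
def iteratedDerivFun (h : 𝓢(E, ℂ)) (l : ℕ) (x : E) : DerivSpace E l := iteratedFDeriv ℝ l h x

theorem continuous_iteratedDerivFun (h : 𝓢(E, ℂ)) (l : ℕ) : Continuous (iteratedDerivFun h l) :=
  (h.smooth ⊤).continuous_iteratedFDeriv (mod_cast le_top)

theorem norm_iteratedDerivFun (h : 𝓢(E, ℂ)) (l : ℕ) (x : E) :
    ‖iteratedDerivFun h l x‖ = ‖iteratedFDeriv ℝ l h x‖ := rfl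

theorem iteratedDerivFun_add (f g : 𝓢(E, ℂ)) (l : ℕ) (x : E) :
    iteratedDerivFun (f + g) l x = iteratedDerivFun f l x + iteratedDerivFun g l x :=
  iteratedFDeriv_add_apply ((smooth _ ⊤).contDiffAt.of_le (mod_cast le_top))
    ((smooth _ ⊤).contDiffAt.of_le (mod_cast le_top))

theorem iteratedDerivFun_smul (c : ℂ) (f : 𝓢(E, ℂ)) (l : ℕ) (x : E) :
    iteratedDerivFun (c • f) l x = c • iteratedDerivFun f l x :=
  iteratedFDeriv_const_smul_apply ((smooth _ ⊤).contDiffAt.of_le (mod_cast le_top))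

theorem norm_weighted_iteratedDerivFun (h : 𝓢(E, ℂ)) (k l : ℕ) (x : E) :
    ‖((‖x‖ ^ k : ℝ) : ℂ) • iteratedDerivFun h l x‖ = ‖x‖ ^ k * ‖iteratedFDeriv ℝ l h x‖ := by
  rw [norm_smul, Complex.norm_real, norm_pow, norm_norm, norm_iteratedDerivFun]

/-- The map `h ↦ ‖·‖ ^ k D^l h` from the Schwartz space to bounded continuous functions; its norm
is the Schwartz seminorm of indices `k, l`. -/
def weightedDerivCLM (E : Type*) [NormedAddCommGroup E] [NormedSpace ℝ E] (i : ℕ × ℕ) :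
    𝓢(E, ℂ) →L[ℂ] BoundedContinuousFunction E (DerivSpace E i.2) :=
  mkCLMtoNormedSpace
    (fun h => BoundedContinuousFunction.ofNormedAddCommGroup
      (fun x => ((‖x‖ ^ i.1 : ℝ) : ℂ) • iteratedDerivFun h i.2 x)
      ((Complex.continuous_ofReal.comp (continuous_norm.pow _)).smul
        (continuous_iteratedDerivFun h _))
      (SchwartzMap.seminorm ℂ i.1 i.2 h) (fun x => by
        rw [norm_weighted_iteratedDerivFun]; exact le_seminorm ℂ _ _ h x))
    (fun f g => by
      ext1 x
      simp only [BoundedContinuousFunction.coe_ofNormedAddCommGroup,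
        BoundedContinuousFunction.coe_add, Pi.add_apply, iteratedDerivFun_add, smul_add])
    (fun c f => by
      ext1 x
      simp only [BoundedContinuousFunction.coe_ofNormedAddCommGroup,
        BoundedContinuousFunction.coe_smul, RingHom.id_apply, iteratedDerivFun_smul]
      rw [smul_comm c])
    ⟨{i}, 1, zero_le_one, fun f => by
      rw [one_mul, Finset.sup_singleton]
      exact BoundedContinuousFunction.norm_ofNormedAddCommGroup_le _ (apply_nonneg _ _) _⟩

theorem weightedDerivCLM_apply (i : ℕ × ℕ) (h : 𝓢(E, ℂ)) (x : E) :
    weightedDerivCLM E i h x = ((‖x‖ ^ i.1 : ℝ) : ℂ) • iteratedDerivFun h i.2 x := rfl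

theorem norm_weightedDerivCLM (i : ℕ × ℕ) (h : 𝓢(E, ℂ)) :
    ‖weightedDerivCLM E i h‖ = SchwartzMap.seminorm ℂ i.1 i.2 h := by
  refine le_antisymm ((BoundedContinuousFunction.norm_le (apply_nonneg _ _)).2 fun x => by
      rw [weightedDerivCLM_apply, norm_weighted_iteratedDerivFun]; exact le_seminorm ℂ _ _ h x)
    (seminorm_le_bound _ _ _ _ (norm_nonneg _) fun x => ?_)
  rw [← norm_weighted_iteratedDerivFun, ← weightedDerivCLM_apply]
  exact (weightedDerivCLM E i h).norm_coe_le_norm x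

/-- Every tempered distribution factors through finitely many weighted derivatives, as a bounded
functional on a product of spaces of bounded continuous functions. -/
theorem exists_dual_factorization (T : 𝓢(E, ℂ) →L[ℂ] ℂ) :
    ∃ (s : Finset (ℕ × ℕ))
      (g : StrongDual ℂ (∀ i : s, BoundedContinuousFunction E (DerivSpace E i.1.2))),
      ∀ h, T h = g fun i => weightedDerivCLM E i.1 h := by
  obtain ⟨s, C, -, hC⟩ := Seminorm.bound_of_continuous (schwartz_withSeminorms ℂ E ℂ)
    ((normSeminorm ℂ ℂ).comp T.toLinearMap) (continuous_norm.comp T.continuous)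
  set J : 𝓢(E, ℂ) →L[ℂ] ∀ i : s, BoundedContinuousFunction E (DerivSpace E i.1.2) :=
    ContinuousLinearMap.pi fun i => weightedDerivCLM E i.1
  have hTJ : ∀ h, ‖T h‖ ≤ C * ‖J h‖ := by
    intro h
    refine (hC h).trans ?_
    rw [smul_apply, NNReal.smul_def, smul_eq_mul]
    gcongr
    refine Seminorm.finset_sup_apply_le (norm_nonneg _) fun i hi => ?_
    rw [schwartzSeminormFamily_apply, ← norm_weightedDerivCLM]
    exact norm_le_pi_norm (J h) ⟨i, hi⟩
  have hker : LinearMap.ker J.toLinearMap ≤ LinearMap.ker T.toLinearMap := by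
    intro h hh
    have h0 : ‖J h‖ = 0 := norm_eq_zero.2 hh
    have := hTJ h
    rw [h0, mul_zero] at this
    exact norm_le_zero_iff.1 this
  set T₀ : LinearMap.range J.toLinearMap →ₗ[ℂ] ℂ :=
    (LinearMap.ker J.toLinearMap).liftQ T.toLinearMap hker ∘ₗ
      J.toLinearMap.quotKerEquivRange.symm.toLinearMap
  have hT₀ : ∀ h, T₀ ⟨J h, h, rfl⟩ = T h := by
    intro h
    have : J.toLinearMap.quotKerEquivRange.symm ⟨J h, h, rfl⟩
        = (LinearMap.ker J.toLinearMap).mkQ h := by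
      rw [LinearEquiv.symm_apply_eq]; rfl
    simp only [T₀, LinearMap.comp_apply, LinearEquiv.coe_coe, this]
    rfl
  obtain ⟨g, hg, -⟩ := exists_extension_norm_eq (LinearMap.range J.toLinearMap)
    (T₀.mkContinuous C (by rintro ⟨_, h, rfl⟩; exact (hT₀ h).symm ▸ hTJ h))
  exact ⟨s, g, fun h => ((hg ⟨J h, h, rfl⟩).trans (hT₀ h)).symm⟩

end BoundedEmbedding

section Convolution

variable {E : Type*} [NormedAddCommGroup E] [InnerProductSpace ℝ E] [FiniteDimensional ℝ E]
  [MeasurableSpace E] [BorelSpace E]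

/-- Convolution of complex-valued Schwartz functions. -/
abbrev conv (φ h : 𝓢(E, ℂ)) : 𝓢(E, ℂ) := convolution (mul ℂ ℂ) φ h

theorem conv_apply (φ h : 𝓢(E, ℂ)) (x : E) : conv φ h x = ∫ z, φ z * h (x - z) :=
  convolution_apply _ _ _ _

theorem lineDerivOp_conv (φ h : 𝓢(E, ℂ)) (m : E) : ∂_{m} (conv φ h) = conv φ (∂_{m} h) := by
  have hm : (inner ℝ · m : E → ℝ).HasTemperateGrowth := by fun_prop
  refine (FourierTransform.fourierEquiv ℂ 𝓢(E, ℂ) (F := 𝓢(E, ℂ))).injective ?_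
  ext x
  change 𝓕 (∂_{m} (conv φ h)) x = 𝓕 (conv φ (∂_{m} h)) x
  rw [fourier_convolution, fourier_lineDerivOp_eq, fourier_lineDerivOp_eq, fourier_convolution]
  simp [hm]
  ring

theorem iteratedLineDerivOp_conv (φ h : 𝓢(E, ℂ)) {l : ℕ} (m : Fin l → E) :
    ∂^{m} (conv φ h) = conv φ (∂^{m} h) := by
  induction l with
  | zero => simp
  | succ l ih =>
    rw [iteratedLineDerivOp_succ_left, iteratedLineDerivOp_succ_left, ih, lineDerivOp_conv]

theorem integrable_mul_one_add_pow (φ : 𝓢(E, ℂ)) (k : ℕ) :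
    Integrable fun z => ‖φ z‖ * (1 + ‖z‖) ^ k := by
  have h1 : Integrable fun z => 2 ^ (k - 1) * (‖φ z‖ + ‖z‖ ^ k * ‖φ z‖) :=
    (φ.integrable.norm.add (φ.integrable_pow_mul volume k)).const_mul _
  refine h1.mono' (by fun_prop) (Eventually.of_forall fun z => ?_)
  rw [Real.norm_of_nonneg (by positivity)]
  have := add_pow_le zero_le_one (norm_nonneg z) k
  rw [one_pow] at this
  calc ‖φ z‖ * (1 + ‖z‖) ^ k ≤ ‖φ z‖ * (2 ^ (k - 1) * (1 + ‖z‖ ^ k)) := by gcongr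
    _ = _ := by ring

theorem integrable_smul_weightedDerivCLM (φ h : 𝓢(E, ℂ)) (i : ℕ × ℕ) :
    Integrable fun z => φ z • weightedDerivCLM E i (h.compSubConstCLM ℝ z) := by
  obtain ⟨B, hB, hB'⟩ := h.exists_seminorm_compSubConstCLM_le i.1 i.2
  refine ((φ.integrable_mul_one_add_pow i.1).const_mul B).mono' ?_
    (Eventually.of_forall fun z => ?_)
  · exact (φ.continuous.smul ((weightedDerivCLM E i).continuous.comp
      h.continuous_compSubConstCLM)).aestronglyMeasurable
  · rw [norm_smul, norm_weightedDerivCLM]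
    calc ‖φ z‖ * SchwartzMap.seminorm ℂ i.1 i.2 (h.compSubConstCLM ℝ z)
        ≤ ‖φ z‖ * (B * (1 + ‖z‖) ^ i.1) := by gcongr; exact hB' z
      _ = _ := by ring

theorem integral_smul_weightedDerivCLM (φ h : 𝓢(E, ℂ)) (i : ℕ × ℕ) :
    ∫ z, φ z • weightedDerivCLM E i (h.compSubConstCLM ℝ z) = weightedDerivCLM E i (conv φ h) := by
  ext1 x
  refine ContinuousMultilinearMap.ext fun m => ?_
  have hint := integrable_smul_weightedDerivCLM φ h i
  set L := (DerivSpace.evalCLM m).comp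
    (BoundedContinuousFunction.evalCLM (β := DerivSpace E i.2) ℂ x)
  calc L (∫ z, φ z • weightedDerivCLM E i (h.compSubConstCLM ℝ z))
      = ∫ z, L (φ z • weightedDerivCLM E i (h.compSubConstCLM ℝ z)) :=
        (L.integral_comp_comm hint).symm
    _ = ∫ z, ((‖x‖ ^ i.1 : ℝ) : ℂ) * (φ z * (∂^{m} h) (x - z)) := by
        congr 1
        ext z
        have : L (φ z • weightedDerivCLM E i (h.compSubConstCLM ℝ z))
            = φ z * (((‖x‖ ^ i.1 : ℝ) : ℂ) *
              iteratedFDeriv ℝ i.2 (h.compSubConstCLM ℝ z) x m) := rfl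
        rw [this, ← iteratedLineDerivOp_eq_iteratedFDeriv, iteratedLineDerivOp_compSubConstCLM,
          compSubConstCLM_apply]
        ring
    _ = ((‖x‖ ^ i.1 : ℝ) : ℂ) * conv φ (∂^{m} h) x := by
        rw [integral_const_mul, conv_apply]
    _ = L (weightedDerivCLM E i (conv φ h)) := by
        rw [← iteratedLineDerivOp_conv, iteratedLineDerivOp_eq_iteratedFDeriv]
        rfl

/-- A tempered distribution commutes with superpositions of translates of a Schwartz function. The
Schwartz space is not normed, so the integral is taken in the spaces of bounded continuous
functions through which the distribution factors. -/
theorem _root_.TemperedDistribution.apply_conv (T : 𝓢'(E, ℂ)) (φ h : 𝓢(E, ℂ)) :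
    T (conv φ h) = ∫ z, φ z * T (h.compSubConstCLM ℝ z) := by
  obtain ⟨s, g, hg⟩ := exists_dual_factorization (E := E) (T : 𝓢(E, ℂ) →L[ℂ] ℂ)
  have hg' : ∀ h : 𝓢(E, ℂ), T h = g fun i => weightedDerivCLM E i.1 h := hg
  have hint : Integrable fun z =>
      φ z • (fun i : s => weightedDerivCLM E i.1 (h.compSubConstCLM ℝ z)) :=
    Integrable.of_eval fun i => integrable_smul_weightedDerivCLM φ h i.1
  have h1 : (fun i : s => weightedDerivCLM E i.1 (conv φ h))
      = ∫ z, φ z • (fun i : s => weightedDerivCLM E i.1 (h.compSubConstCLM ℝ z)) := by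
    ext1 i
    rw [eval_integral fun j => integrable_smul_weightedDerivCLM φ h j.1]
    exact (integral_smul_weightedDerivCLM φ h i.1).symm
  rw [hg', h1, ← g.integral_comp_comm hint]
  congr 1
  ext z
  rw [map_smul, ← hg', smul_eq_mul]

theorem _root_.TemperedDistribution.norm_apply_conv_le (T : 𝓢'(E, ℂ)) (φ h : 𝓢(E, ℂ)) {M : ℝ}
    (hM : ∀ z, ‖T (h.compSubConstCLM ℝ z)‖ ≤ M) : ‖T (conv φ h)‖ ≤ M * ∫ z, ‖φ z‖ := by
  rw [TemperedDistribution.apply_conv, ← integral_const_mul]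
  refine norm_integral_le_of_norm_le (φ.integrable.norm.const_mul M)
    (Eventually.of_forall fun z => ?_)
  rw [norm_mul, mul_comm]
  exact mul_le_mul_of_nonneg_right (hM z) (norm_nonneg _)

end Convolution

end SchwartzMap

end Interchange

namespace SchwartzMap

variable {E : Type*} [NormedAddCommGroup E] [InnerProductSpace ℝ E]

/-! ### Dilations, translations and products on the Fourier side -/

section Dilate

/-- The dilation `P ↦ P (c • ·)` of Schwartz functions. -/
def dilate (c : ℝ) (hc : c ≠ 0) : 𝓢(E, ℂ) →L[ℂ] 𝓢(E, ℂ) :=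
  compCLMOfContinuousLinearEquiv ℂ (ContinuousLinearEquiv.smulLeft (Units.mk0 c hc))

@[simp]
theorem dilate_apply (c : ℝ) (hc : c ≠ 0) (P : 𝓢(E, ℂ)) (x : E) : dilate c hc P x = P (c • x) :=
  rfl

variable [FiniteDimensional ℝ E] [MeasurableSpace E] [BorelSpace E]

theorem fourier_dilate_apply (c : ℝ) (hc : c ≠ 0) (P : 𝓢(E, ℂ)) (x : E) :
    𝓕 (dilate c hc P) x = ((|(c ^ Module.finrank ℝ E)⁻¹| : ℝ) : ℂ) * 𝓕 P (c⁻¹ • x) := by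
  rw [fourier_coe, fourier_coe, Real.fourier_eq, Real.fourier_eq, ← Complex.real_smul,
    ← Measure.integral_comp_smul volume
      (fun v : E => Real.fourierChar (-inner ℝ v (c⁻¹ • x)) • P v) c]
  congr 1
  ext v
  rw [real_inner_smul_left, real_inner_smul_right, mul_inv_cancel_left₀ hc, dilate_apply]

theorem integral_norm_dilate (c : ℝ) (hc : 0 < c) (P : 𝓢(E, ℂ)) :
    ∫ x, ‖P (c • x)‖ = (c ^ Module.finrank ℝ E)⁻¹ * ∫ x, ‖P x‖ := by
  rw [Measure.integral_comp_smul_of_nonneg volume (fun x => ‖P x‖) c (hR := hc.le), smul_eq_mul]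

theorem fourierInv_apply_eq_fourier_neg (P : 𝓢(E, ℂ)) (x : E) : 𝓕⁻ P x = 𝓕 P (-x) := by
  rw [fourierInv_coe, fourier_coe, Real.fourierInv_eq_fourier_neg]

/-- The inverse Fourier transform turns translation into modulation. -/
theorem fourierInv_compSubConstCLM_fourier_apply (m : 𝓢(E, ℂ)) (x ξ : E) :
    𝓕⁻ ((𝓕 m : 𝓢(E, ℂ)).compSubConstCLM ℝ x) ξ = Real.fourierChar (inner ℝ x ξ) * m ξ := by
  have h1 : m ξ = (𝓕⁻ (𝓕 m : 𝓢(E, ℂ)) : 𝓢(E, ℂ)) ξ := by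
    rw [FourierTransform.fourierInv_fourier_eq]
  rw [h1, fourierInv_coe, fourierInv_coe, Real.fourierInv_eq, Real.fourierInv_eq,
    ← integral_add_right_eq_self _ x, ← integral_const_mul]
  congr 1
  ext v
  rw [compSubConstCLM_apply, add_sub_cancel_right, inner_add_left, add_comm, AddChar.map_add_eq_mul,
    mul_smul, Circle.smul_def (Real.fourierChar (inner ℝ x ξ)), smul_eq_mul]

/-- The convolution theorem for the inverse Fourier transform. -/
theorem conv_fourier (m φ : 𝓢(E, ℂ)) :
    conv (𝓕 m) φ = 𝓕 (smulLeftCLM ℂ m (𝓕⁻ φ)) := by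
  have hneg : (-1 : ℝ) ≠ 0 := by norm_num
  -- both sides are conjugate under the reflection, which intertwines the two transforms
  have hF : ∀ P : 𝓢(E, ℂ), 𝓕⁻ P = dilate (-1) hneg (𝓕 P) := fun P => by
    ext x; rw [fourierInv_apply_eq_fourier_neg, dilate_apply, neg_one_smul]
  refine (FourierTransform.fourierEquiv ℂ 𝓢(E, ℂ) (F := 𝓢(E, ℂ))).symm.injective ?_
  change 𝓕⁻ (conv (𝓕 m) φ) = 𝓕⁻ (𝓕 (smulLeftCLM ℂ m (𝓕⁻ φ)))
  rw [FourierTransform.fourierInv_fourier_eq, hF, fourier_convolution]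
  ext x
  rw [smulLeftCLM_apply_apply m.hasTemperateGrowth, fourierInv_apply_eq_fourier_neg, dilate_apply,
    neg_one_smul, pairing_apply_apply, ← fourierInv_apply_eq_fourier_neg,
    FourierTransform.fourierInv_fourier_eq]
  rfl

theorem conv_comm (φ h : 𝓢(E, ℂ)) : conv φ h = conv h φ := by
  have : ContinuousLinearMap.mul ℂ ℂ = (ContinuousLinearMap.mul ℂ ℂ).flip := by
    ext; simp
  rw [conv, this, convolution_flip]

theorem conv_compSubConstCLM (φ h : 𝓢(E, ℂ)) (x : E) :
    (conv φ h).compSubConstCLM ℝ x = conv (φ.compSubConstCLM ℝ x) h := by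
  ext y
  rw [compSubConstCLM_apply, conv_apply, conv_apply,
    ← integral_sub_right_eq_self (fun z => φ z * h (y - x - z)) x]
  congr 1
  ext z
  rw [compSubConstCLM_apply]
  congr 2
  abel

theorem integral_norm_compSubConstCLM (φ : 𝓢(E, ℂ)) (x : E) :
    ∫ z, ‖φ.compSubConstCLM ℝ x z‖ = ∫ z, ‖φ z‖ :=
  integral_sub_right_eq_self (fun z => ‖φ z‖) x

/-- Young's inequality in `L¹`. -/
theorem integral_norm_conv_le (φ h : 𝓢(E, ℂ)) :
    ∫ x, ‖conv φ h x‖ ≤ (∫ x, ‖φ x‖) * ∫ x, ‖h x‖ := by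
  have hφ := φ.integrable (μ := volume).norm
  have hh := h.integrable (μ := volume).norm
  have h1 := integral_convolution (ContinuousLinearMap.mul ℝ ℝ) (μ := volume) (ν := volume) hφ hh
  rw [ContinuousLinearMap.mul_apply'] at h1
  rw [← h1]
  refine integral_mono (conv φ h).integrable.norm (hφ.integrable_convolution _ hh) fun x => ?_
  dsimp only
  rw [conv_apply]
  refine (norm_integral_le_integral_norm _).trans_eq ?_
  simp only [norm_mul]
  rfl

end Dilate

/-! ### The Littlewood–Paley decomposition -/

section LittlewoodPaley

/-- A smooth bump function, equal to `1` on the unit ball and supported in the ball of radius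
`2`. -/
def lpBump (E : Type*) [NormedAddCommGroup E] [InnerProductSpace ℝ E] : ContDiffBump (0 : E) where
  rIn := 1
  rOut := 2
  rIn_pos := one_pos
  rIn_lt_rOut := one_lt_two

/-- The Littlewood–Paley cutoff `lpBump ξ - lpBump (2 ξ)`, supported in the annulus
`1 / 2 ≤ ‖ξ‖ ≤ 2`; its dyadic dilates sum to `1` away from `0`. -/
def lpCutoff (ξ : E) : ℝ := lpBump E ξ - lpBump E ((2 : ℝ) • ξ)

theorem lpBump_eq_one {ξ : E} (h : ‖ξ‖ ≤ 1) : lpBump E ξ = 1 :=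
  (lpBump E).one_of_mem_closedBall (mem_closedBall_zero_iff.2 h)

theorem lpBump_eq_zero {ξ : E} (h : 2 ≤ ‖ξ‖) : lpBump E ξ = 0 :=
  (lpBump E).zero_of_le_dist ((dist_zero_right ξ).symm ▸ h)

theorem contDiff_lpBump {N : ℕ∞} : ContDiff ℝ N (lpBump E) := (lpBump E).contDiff

theorem contDiff_lpCutoff : ContDiff ℝ ∞ (lpCutoff : E → ℝ) :=
  contDiff_lpBump.sub (contDiff_lpBump.comp (contDiff_const_smul _))

theorem lpCutoff_eq_zero_of_le {ξ : E} (h : ‖ξ‖ ≤ 1 / 2) : lpCutoff ξ = 0 := by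
  rw [lpCutoff, lpBump_eq_one (by linarith), lpBump_eq_one, sub_self]
  rw [norm_smul, Real.norm_ofNat]; linarith

theorem lpCutoff_eq_zero_of_ge {ξ : E} (h : 2 ≤ ‖ξ‖) : lpCutoff ξ = 0 := by
  rw [lpCutoff, lpBump_eq_zero h, lpBump_eq_zero, sub_self]
  rw [norm_smul, Real.norm_ofNat]; linarith

/-- The dyadic cutoffs telescope. -/
theorem sum_range_lpCutoff (a : ℤ) (k : ℕ) (ξ : E) :
    ∑ i ∈ Finset.range k, lpCutoff ((2 : ℝ) ^ (-(a + i)) • ξ)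
      = lpBump E ((2 : ℝ) ^ (1 - (a + k)) • ξ) - lpBump E ((2 : ℝ) ^ (1 - a) • ξ) := by
  have h := Finset.sum_range_sub (fun i : ℕ => lpBump E ((2 : ℝ) ^ (1 - (a + i)) • ξ)) k
  simp only [Nat.cast_zero, add_zero] at h
  rw [← h]
  refine Finset.sum_congr rfl fun i _ => ?_
  rw [lpCutoff, smul_smul, ← zpow_one_add₀ two_ne_zero]
  congr 4
  push_cast
  ring_nf

/-- The symmetric block `{-N, …, N - 1}` of dyadic scales. -/
def dyadicBlock (N : ℕ) : Finset ℤ := (Finset.range (2 * N)).image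
  fun i : ℕ => -(N : ℤ) + i

theorem mem_dyadicBlock {N : ℕ} {j : ℤ} : j ∈ dyadicBlock N ↔ -(N : ℤ) ≤ j ∧ j < N := by
  simp only [dyadicBlock, Finset.mem_image, Finset.mem_range]
  constructor
  · rintro ⟨i, hi, rfl⟩; omega
  · intro h; exact ⟨(j + N).toNat, by omega, by omega⟩

theorem tendsto_dyadicBlock : Tendsto dyadicBlock atTop atTop := by
  refine tendsto_atTop_finset_of_monotone (fun M N h j hj => ?_) fun j => ⟨j.natAbs + 1, ?_⟩
  · rw [mem_dyadicBlock] at hj ⊢; omega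
  · rw [mem_dyadicBlock]; omega

theorem sum_dyadicBlock_lpCutoff (N : ℕ) (ξ : E) :
    ∑ j ∈ dyadicBlock N, lpCutoff ((2 : ℝ) ^ (-j) • ξ)
      = lpBump E ((2 : ℝ) ^ (1 - (N : ℤ)) • ξ) - lpBump E ((2 : ℝ) ^ (1 + (N : ℤ)) • ξ) := by
  rw [dyadicBlock, Finset.sum_image fun i _ j _ h => by simpa using h]
  refine (sum_range_lpCutoff (-(N : ℤ)) (2 * N) ξ).trans ?_
  congr 4 <;> (push_cast; ring_nf)

variable [FiniteDimensional ℝ E]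

theorem hasCompactSupport_of_norm_ge {F : Type*} [Zero F] {m : E → F} {r : ℝ}
    (h : ∀ ξ, r ≤ ‖ξ‖ → m ξ = 0) : HasCompactSupport m :=
  HasCompactSupport.of_support_subset_isCompact (isCompact_closedBall (0 : E) r) fun ξ hξ => by
    rw [mem_closedBall_zero_iff]
    by_contra hlt
    exact hξ (h ξ (not_le.1 hlt).le)

theorem hasTemperateGrowth_lpBump_smul (t : ℝ) :
    (fun ξ : E => ((lpBump E (t • ξ) : ℝ) : ℂ)).HasTemperateGrowth :=
  ((hasCompactSupport_of_norm_ge (r := 2) fun ξ h => by simp [lpBump_eq_zero h]).hasTemperateGrowth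
    (f := fun ξ : E => ((lpBump E ξ : ℝ) : ℂ))
    (Complex.ofRealCLM.contDiff.comp contDiff_lpBump)).comp
    (t • ContinuousLinearMap.id ℝ E).hasTemperateGrowth

/-- The frequency cutoff to a large ball converges strongly to the identity on Schwartz space, as
`c N → 0`. -/
theorem tendsto_smulLeftCLM_lpBump (ψ : 𝓢(E, ℂ)) {c : ℕ → ℝ} (hc0 : ∀ N, 0 ≤ c N)
    (hc : Tendsto c atTop (𝓝 0)) :
    Tendsto (fun N => smulLeftCLM ℂ (fun ξ : E => ((lpBump E (c N • ξ) : ℝ) : ℂ)) ψ) atTop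
      (𝓝 ψ) := by
  have hB : ContDiff ℝ ∞ fun ξ : E => ((lpBump E ξ : ℝ) : ℂ) :=
    Complex.ofRealCLM.contDiff.comp contDiff_lpBump
  have hBs : HasCompactSupport fun ξ : E => ((lpBump E ξ : ℝ) : ℂ) :=
    hasCompactSupport_of_norm_ge (r := 2) fun ξ h => by simp [lpBump_eq_zero h]
  have hBg := hasTemperateGrowth_lpBump_smul (E := E)
  -- the derivatives of `lpBump (t ξ) - 1` are `O (t (1 + ‖ξ‖))`
  have hbound : ∀ i : ℕ, ∃ K : ℝ, 0 ≤ K ∧ ∀ t ∈ Set.Icc (0 : ℝ) 1, ∀ x : E,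
      ‖iteratedFDeriv ℝ i (fun ξ : E => ((lpBump E (t • ξ) : ℝ) : ℂ) - 1) x‖
        ≤ K * t * (1 + ‖x‖) := by
    intro i
    rcases Nat.eq_zero_or_pos i with rfl | hi
    · obtain ⟨K, hK⟩ := hB.lipschitzWith_of_hasCompactSupport hBs (by simp)
      refine ⟨K, K.2, fun t ht x => ?_⟩
      rw [norm_iteratedFDeriv_zero]
      have := hK.norm_sub_le (t • x) 0
      rw [lpBump_eq_one (ξ := (0 : E)) (by simp), sub_zero, norm_smul, Real.norm_of_nonneg ht.1,
        Complex.ofReal_one] at this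
      refine this.trans ?_
      rw [mul_assoc]
      have := mul_nonneg K.2 ht.1
      gcongr
      · exact ht.1
      · linarith
    · obtain ⟨K, hK⟩ := (hB.continuous_iteratedFDeriv (m := i)
        (mod_cast le_top)).bounded_above_of_compact_support (hBs.iteratedFDeriv i)
      refine ⟨K, (norm_nonneg _).trans (hK 0), fun t ht x => ?_⟩
      have hK0 : 0 ≤ K := (norm_nonneg _).trans (hK 0)
      have h1 : iteratedFDeriv ℝ i (fun ξ : E => ((lpBump E (t • ξ) : ℝ) : ℂ) - 1) x
          = iteratedFDeriv ℝ i (fun ξ : E => ((lpBump E (t • ξ) : ℝ) : ℂ)) x := by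
        have h2 : ContDiffAt ℝ i (fun ξ : E => ((lpBump E (t • ξ) : ℝ) : ℂ)) x :=
          ((hBg t).1.of_le (mod_cast le_top)).contDiffAt
        have := iteratedFDeriv_sub_apply h2 (contDiffAt_const (c := (1 : ℂ)))
        rw [iteratedFDeriv_const_of_ne hi.ne', Pi.zero_apply, sub_zero] at this
        exact this
      rw [h1]
      have h3 := (t • ContinuousLinearMap.id ℝ E).iteratedFDeriv_comp_right hB x
        (i := i) (mod_cast le_top)
      have h4 : (fun ξ : E => ((lpBump E (t • ξ) : ℝ) : ℂ))
          = (fun ξ : E => ((lpBump E ξ : ℝ) : ℂ)) ∘ (t • ContinuousLinearMap.id ℝ E) := rfl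
      rw [h4, h3]
      refine (ContinuousMultilinearMap.norm_compContinuousLinearMap_le _ _).trans ?_
      rw [Finset.prod_const, Finset.card_univ, Fintype.card_fin]
      have h5 : ‖t • ContinuousLinearMap.id ℝ E‖ ≤ t := by
        rw [norm_smul, Real.norm_of_nonneg ht.1]
        exact mul_le_of_le_one_right ht.1 ContinuousLinearMap.norm_id_le
      calc _ ≤ K * t ^ i := by gcongr; exact hK _
        _ ≤ K * t := by gcongr; exact pow_le_of_le_one ht.1 ht.2 hi.ne'
        _ ≤ K * t * (1 + ‖x‖) := le_mul_of_one_le_right (mul_nonneg hK0 ht.1)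
          (by linarith [norm_nonneg x])
  choose K hK0 hK using hbound
  refine ((schwartz_withSeminorms ℂ E ℂ).tendsto_nhds _ _).2 ?_
  rintro ⟨k, l⟩ ε hε
  set D : ℝ := ∑ i ∈ Finset.range (l + 1), (l.choose i : ℝ) * K i *
    (SchwartzMap.seminorm ℂ k (l - i) ψ + SchwartzMap.seminorm ℂ (k + 1) (l - i) ψ)
  have hD : 0 ≤ D := Finset.sum_nonneg fun i _ => mul_nonneg
    (mul_nonneg (Nat.cast_nonneg _) (hK0 i)) (add_nonneg (apply_nonneg _ _) (apply_nonneg _ _))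
  have key : ∀ N, c N ≤ 1 → SchwartzMap.seminorm ℂ k l
      (smulLeftCLM ℂ (fun ξ : E => ((lpBump E (c N • ξ) : ℝ) : ℂ)) ψ - ψ) ≤ D * c N := by
    intro N hN
    refine seminorm_le_bound _ _ _ _ (mul_nonneg hD (hc0 N)) fun x => ?_
    have hfun : (⇑(smulLeftCLM ℂ (fun ξ : E => ((lpBump E (c N • ξ) : ℝ) : ℂ)) ψ - ψ) : E → ℂ)
        = fun y => (((lpBump E (c N • y) : ℝ) : ℂ) - 1) * ψ y := by
      ext y
      rw [sub_apply, smulLeftCLM_apply_apply (hBg _), smul_eq_mul]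
      ring
    rw [hfun]
    have hle := norm_iteratedFDeriv_mul_le (N := ∞)
      ((hBg (c N)).1.sub (contDiff_const (c := (1 : ℂ))))
      (ψ.smooth ⊤) x (n := l) (mod_cast le_top)
    calc ‖x‖ ^ k * _ ≤ ‖x‖ ^ k * ∑ i ∈ Finset.range (l + 1), (l.choose i : ℝ) *
          (K i * c N * (1 + ‖x‖)) * ‖iteratedFDeriv ℝ (l - i) ψ x‖ := by
          refine mul_le_mul_of_nonneg_left (hle.trans (Finset.sum_le_sum fun i _ => ?_))
            (by positivity)
          gcongr
          exact hK i (c N) ⟨hc0 N, hN⟩ x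
      _ ≤ D * c N := by
          rw [Finset.mul_sum, Finset.sum_mul]
          refine Finset.sum_le_sum fun i _ => ?_
          have h1 := le_seminorm ℂ k (l - i) ψ x
          have h2 := le_seminorm ℂ (k + 1) (l - i) ψ x
          calc _ = (l.choose i : ℝ) * K i * (‖x‖ ^ k * ‖iteratedFDeriv ℝ (l - i) ψ x‖
                + ‖x‖ ^ (k + 1) * ‖iteratedFDeriv ℝ (l - i) ψ x‖) * c N := by ring
            _ ≤ _ := by
              have := hK0 i
              have := hc0 N
              gcongr
  have hlim : Tendsto (fun N => D * c N) atTop (𝓝 0) := by simpa using hc.const_mul D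
  filter_upwards [hlim.eventually (gt_mem_nhds hε), hc.eventually (ge_mem_nhds one_pos)]
    with N h1 h2
  exact (key N h2).trans_lt h1

end LittlewoodPaley

end SchwartzMap

namespace SchwartzMap

variable {E : Type*} [NormedAddCommGroup E] [InnerProductSpace ℝ E]

/-! ### Symbols supported in dyadic annuli -/

theorem zero_notMem_tsupport_of_norm_le {E : Type*} [NormedAddCommGroup E]
    {m : E → ℂ} {r : ℝ} (hr : 0 < r)
    (h : ∀ ξ, ‖ξ‖ ≤ r → m ξ = 0) : (0 : E) ∉ tsupport m := by
  rw [notMem_tsupport_iff_eventuallyEq]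
  filter_upwards [Metric.closedBall_mem_nhds (0 : E) hr] with ξ hξ
  exact h ξ (mem_closedBall_zero_iff.1 hξ)

theorem two_zpow_pos (j : ℤ) : (0 : ℝ) < 2 ^ j := zpow_pos two_pos j

/-- The homogeneous rescaling `2 ^ (j σ) P (2 ^ (-j) ·)` of a symbol `P` to the frequency
`2 ^ j`. -/
def dyadicSymbol (σ : ℝ) (j : ℤ) (P : 𝓢(E, ℂ)) : 𝓢(E, ℂ) :=
  ((((2 : ℝ) ^ j) ^ σ : ℝ) : ℂ) • dilate ((2 : ℝ) ^ (-j)) (two_zpow_pos _).ne' P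

theorem dyadicSymbol_apply (σ : ℝ) (j : ℤ) (P : 𝓢(E, ℂ)) (ξ : E) :
    dyadicSymbol σ j P ξ = ((((2 : ℝ) ^ j) ^ σ : ℝ) : ℂ) * P ((2 : ℝ) ^ (-j) • ξ) := rfl

theorem contDiffAt_norm_rpow (σ : ℝ) (ξ : E) (hξ : ξ ≠ 0) :
    ContDiffAt ℝ ∞ (fun ξ : E => (2 * Real.pi * ‖ξ‖) ^ σ) ξ :=
  (contDiffAt_const.mul (contDiffAt_norm ℝ hξ)).rpow_const_of_ne (by
    have := norm_pos_iff.2 hξ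
    positivity)

theorem zpow_rpow_mul_norm_rpow (σ : ℝ) (j : ℤ) (ξ : E) :
    ((2 : ℝ) ^ j) ^ σ * (2 * Real.pi * ‖(2 : ℝ) ^ (-j) • ξ‖) ^ σ = (2 * Real.pi * ‖ξ‖) ^ σ := by
  have h := two_zpow_pos j
  rw [← Real.mul_rpow h.le (by positivity), norm_smul, Real.norm_of_nonneg (two_zpow_pos _).le,
    zpow_neg]
  congr 1
  field_simp

theorem lpCutoff_dyadic_eq_zero_of_le {j : ℤ} {ξ : E} (h : ‖ξ‖ ≤ 2 ^ j / 2) :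
    lpCutoff ((2 : ℝ) ^ (-j) • ξ) = 0 := by
  refine lpCutoff_eq_zero_of_le ?_
  rw [norm_smul, Real.norm_of_nonneg (two_zpow_pos _).le, zpow_neg,
    inv_mul_le_iff₀ (two_zpow_pos _)]
  linarith

variable [FiniteDimensional ℝ E]

/-- The product of `lpCutoff` with a multiplier `k` that is smooth away from the origin. -/
def annulusSymbol (k : E → ℝ) (hk : ∀ ξ ≠ 0, ContDiffAt ℝ ∞ k ξ) : 𝓢(E, ℂ) :=
  HasCompactSupport.toSchwartzMap (f := fun ξ : E => ((k ξ * lpCutoff ξ : ℝ) : ℂ))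
    (hasCompactSupport_of_norm_ge (r := 2) fun ξ h => by simp [lpCutoff_eq_zero_of_ge h])
    (by
      refine contDiff_iff_contDiffAt.2 fun ξ => ?_
      rcases eq_or_ne ξ 0 with rfl | hξ
      · refine (contDiffAt_const (c := (0 : ℂ))).congr_of_eventuallyEq ?_
        filter_upwards [Metric.closedBall_mem_nhds (0 : E) (by norm_num : (0 : ℝ) < 1 / 2)]
          with ζ hζ
        rw [lpCutoff_eq_zero_of_le (mem_closedBall_zero_iff.1 hζ), mul_zero, Complex.ofReal_zero]
      · exact Complex.ofRealCLM.contDiff.contDiffAt.comp ξ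
          ((hk ξ hξ).mul contDiff_lpCutoff.contDiffAt))

@[simp]
theorem annulusSymbol_apply (k : E → ℝ) (hk : ∀ ξ ≠ 0, ContDiffAt ℝ ∞ k ξ) (ξ : E) :
    annulusSymbol k hk ξ = ((k ξ * lpCutoff ξ : ℝ) : ℂ) := rfl

/-- The symbol `(2π‖ξ‖) ^ σ` localized to the annulus `‖ξ‖ ∼ 2 ^ j`. -/
def bandSymbol (E : Type*) [NormedAddCommGroup E] [InnerProductSpace ℝ E] [FiniteDimensional ℝ E]
    (σ : ℝ) (j : ℤ) : 𝓢(E, ℂ) :=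
  dyadicSymbol σ j (annulusSymbol (fun ξ => (2 * Real.pi * ‖ξ‖) ^ σ) (contDiffAt_norm_rpow σ))

theorem bandSymbol_apply (σ : ℝ) (j : ℤ) (ξ : E) : bandSymbol E σ j ξ
    = (((2 * Real.pi * ‖ξ‖) ^ σ * lpCutoff ((2 : ℝ) ^ (-j) • ξ) : ℝ) : ℂ) := by
  rw [bandSymbol, dyadicSymbol_apply, annulusSymbol_apply, ← Complex.ofReal_mul, ← mul_assoc,
    zpow_rpow_mul_norm_rpow]

theorem bandSymbol_eq_zero_of_le (σ : ℝ) {j : ℤ} {ξ : E} (h : ‖ξ‖ ≤ 2 ^ j / 2) :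
    bandSymbol E σ j ξ = 0 := by
  rw [bandSymbol_apply, lpCutoff_dyadic_eq_zero_of_le h, mul_zero, Complex.ofReal_zero]

/-- The factor `(2π‖ξ‖) ^ τ` raises the exponent of the band symbol by `τ`; at `ξ = 0`, where
`0 ^ 0 = 1`, both sides vanish thanks to the cutoff. -/
theorem bandSymbol_add (σ τ : ℝ) (j : ℤ) (ξ : E) :
    bandSymbol E (σ + τ) j ξ = (((2 * Real.pi * ‖ξ‖) ^ τ : ℝ) : ℂ) * bandSymbol E σ j ξ := by
  rcases eq_or_ne ξ 0 with rfl | hξ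
  · have h : ‖(0 : E)‖ ≤ 2 ^ j / 2 := by rw [norm_zero]; exact (half_pos (two_zpow_pos j)).le
    rw [bandSymbol_eq_zero_of_le _ h, bandSymbol_eq_zero_of_le _ h, mul_zero]
  · have := norm_pos_iff.2 hξ
    rw [bandSymbol_apply, bandSymbol_apply, Real.rpow_add (by positivity), ← Complex.ofReal_mul]
    congr 1
    ring

variable [MeasurableSpace E] [BorelSpace E]

theorem fourier_dyadicSymbol_apply (σ : ℝ) (j : ℤ) (P : 𝓢(E, ℂ)) (x : E) :
    𝓕 (dyadicSymbol σ j P) x = ((((2 : ℝ) ^ j) ^ σ : ℝ) : ℂ) *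
      (((((2 : ℝ) ^ j) ^ Module.finrank ℝ E : ℝ) : ℂ) * 𝓕 P ((2 : ℝ) ^ j • x)) := by
  rw [dyadicSymbol, FourierTransform.fourier_smul, smul_apply, smul_eq_mul, fourier_dilate_apply,
    zpow_neg, inv_pow, inv_inv, inv_inv, abs_of_pos (pow_pos (two_zpow_pos j) _)]

theorem integral_norm_fourier_dyadicSymbol (σ : ℝ) (j : ℤ) (P : 𝓢(E, ℂ)) :
    ∫ x, ‖𝓕 (dyadicSymbol σ j P) x‖ = ((2 : ℝ) ^ j) ^ σ * ∫ x, ‖𝓕 P x‖ := by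
  have h := two_zpow_pos j
  simp only [fourier_dyadicSymbol_apply, norm_mul, Complex.norm_real, Real.norm_eq_abs]
  rw [integral_const_mul, integral_const_mul, integral_norm_dilate _ h,
    abs_of_pos (Real.rpow_pos_of_pos h _), abs_of_pos (pow_pos h _),
    mul_inv_cancel_left₀ (pow_pos h _).ne']

end SchwartzMap

/-! ### Factoring the band kernels through the heat kernel -/

section Heat

open SchwartzMap

variable {n : ℕ}

/-- The symbol `(2π‖ξ‖) ^ σ exp (4π²‖ξ‖²)` localized to the unit annulus; it is the quotient of the
symbol of the unit frequency band by that of the heat semigroup at time `1`. -/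
def heatQuotientSymbol (n : ℕ) (σ : ℝ) : 𝓢(EuclideanSpace ℝ (Fin n), ℂ) :=
  annulusSymbol (fun ξ => (2 * Real.pi * ‖ξ‖) ^ σ * Real.exp (4 * Real.pi ^ 2 * ‖ξ‖ ^ 2))
    fun ξ hξ => (contDiffAt_norm_rpow σ ξ hξ).mul
      (Real.contDiff_exp.comp (contDiff_const.mul (contDiff_norm_sq ℝ))).contDiffAt

theorem fourierInv_heatKernel_apply (t : ℝ) (ht : 0 < t) (ξ : EuclideanSpace ℝ (Fin n)) :
    𝓕⁻ (heatKernel n t ht) ξ = ((Real.exp (-(4 * Real.pi ^ 2 * t * ‖ξ‖ ^ 2)) : ℝ) : ℂ) := by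
  have hre : 0 < ((1 / (4 * t) : ℝ) : ℂ).re := by rw [Complex.ofReal_re]; positivity
  have h := fourier_gaussian_innerProductSpace hre (-ξ)
  have hk : ⇑(heatKernel n t ht) = fun y => (((4 * Real.pi * t) ^ (-(n : ℝ) / 2) : ℝ) : ℂ) •
      Complex.exp (-((1 / (4 * t) : ℝ) : ℂ) * ‖y‖ ^ 2) := by
    ext y
    rw [heatKernel_apply, Complex.ofReal_mul, smul_eq_mul, Complex.ofReal_exp]
    congr 2
    push_cast
    ring
  rw [Real.fourier_eq, finrank_euclideanSpace_fin, norm_neg] at h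
  rw [fourierInv_apply_eq_fourier_neg, fourier_coe, hk, Real.fourier_eq]
  simp_rw [smul_comm _ (((4 * Real.pi * t) ^ (-(n : ℝ) / 2) : ℝ) : ℂ)]
  rw [integral_smul, h, smul_eq_mul, ← mul_assoc]
  have h4 : 0 < 4 * Real.pi * t := by positivity
  have h1 : (Real.pi / ((1 / (4 * t) : ℝ) : ℂ)) ^ ((n : ℂ) / 2)
      = (((4 * Real.pi * t) ^ ((n : ℝ) / 2) : ℝ) : ℂ) := by
    rw [Complex.ofReal_cpow h4.le]
    push_cast
    congr 1
    field_simp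
  rw [h1, ← Complex.ofReal_mul, ← Real.rpow_add h4, neg_div, neg_add_cancel, Real.rpow_zero,
    Complex.ofReal_one, one_mul, Complex.ofReal_exp]
  congr 1
  push_cast
  field_simp

/-- The kernel of the band `j` is the convolution of an integrable kernel with the heat kernel at
time `4 ^ (-j)`. -/
theorem fourier_bandSymbol_eq_conv (σ : ℝ) (j : ℤ) (ht : (0 : ℝ) < ((2 : ℝ) ^ (-j)) ^ 2) :
    𝓕 (bandSymbol (EuclideanSpace ℝ (Fin n)) σ j)
      = conv (𝓕 (dyadicSymbol σ j (heatQuotientSymbol n σ))) (heatKernel n _ ht) := by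
  rw [conv_fourier]
  congr 1
  ext ξ
  rw [smulLeftCLM_apply_apply (SchwartzMap.hasTemperateGrowth _), fourierInv_heatKernel_apply,
    dyadicSymbol_apply, heatQuotientSymbol, annulusSymbol_apply, bandSymbol_apply, smul_eq_mul,
    ← Complex.ofReal_mul, ← Complex.ofReal_mul, ← zpow_rpow_mul_norm_rpow σ j ξ]
  congr 1
  have : Real.exp (4 * Real.pi ^ 2 * ‖(2 : ℝ) ^ (-j) • ξ‖ ^ 2) *
      Real.exp (-(4 * Real.pi ^ 2 * ((2 : ℝ) ^ (-j)) ^ 2 * ‖ξ‖ ^ 2)) = 1 := by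
    rw [← Real.exp_add, norm_smul, Real.norm_of_nonneg (two_zpow_pos _).le]
    rw [Real.exp_eq_one_iff]
    ring
  linear_combination (-((2 : ℝ) ^ j) ^ σ * (2 * Real.pi * ‖(2 : ℝ) ^ (-j) • ξ‖) ^ σ *
    lpCutoff ((2 : ℝ) ^ (-j) • ξ)) * this

end Heat

open SchwartzMap

/-! ### The frequency bands of a tempered distribution -/

section Band

variable {n : ℕ}

/-- The smooth function obtained from the tempered distribution `T` by applying the Fourier
multiplier `bandSymbol σ j`, that is, the part of `(-Δ)^{σ/2} T` at frequencies `∼ 2 ^ j`. -/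
def freqBand (T : 𝓢'(EuclideanSpace ℝ (Fin n), ℂ)) (σ : ℝ) (j : ℤ)
    (x : EuclideanSpace ℝ (Fin n)) : ℂ :=
  T ((𝓕 (bandSymbol (EuclideanSpace ℝ (Fin n)) σ j) :
    𝓢(EuclideanSpace ℝ (Fin n), ℂ)).compSubConstCLM ℝ x)

theorem continuous_freqBand (T : 𝓢'(EuclideanSpace ℝ (Fin n), ℂ)) (σ : ℝ) (j : ℤ) :
    Continuous (freqBand T σ j) :=
  T.continuous.comp (continuous_compSubConstCLM _)

/-- On the Fourier side, the band `j` of `T` is the product of `𝓕 T` with the band symbol. -/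
theorem integral_mul_freqBand (T : 𝓢'(EuclideanSpace ℝ (Fin n), ℂ)) (σ : ℝ) (j : ℤ)
    (φ : 𝓢(EuclideanSpace ℝ (Fin n), ℂ)) :
    ∫ x, φ x * freqBand T σ j x
      = T (𝓕 (smulLeftCLM ℂ (bandSymbol (EuclideanSpace ℝ (Fin n)) σ j) (𝓕⁻ φ))) := by
  rw [← conv_fourier, conv_comm, TemperedDistribution.apply_conv]
  rfl

/-- The bands of `(-Δ)^{s/2} f` are those of `f`, with the exponent shifted by `s`. -/
theorem IsFracLaplacian.freqBand_eq {s : ℝ} {f F : 𝓢'(EuclideanSpace ℝ (Fin n), ℂ)}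
    (h : IsFracLaplacian s f F) (σ : ℝ) (j : ℤ) (x : EuclideanSpace ℝ (Fin n)) :
    freqBand F σ j x = freqBand f (σ + s) j x := by
  have key := h.fourier_eq
    (𝓕⁻ ((𝓕 (bandSymbol (EuclideanSpace ℝ (Fin n)) σ j) :
      𝓢(EuclideanSpace ℝ (Fin n), ℂ)).compSubConstCLM ℝ x))
    (𝓕⁻ ((𝓕 (bandSymbol (EuclideanSpace ℝ (Fin n)) (σ + s) j) :
      𝓢(EuclideanSpace ℝ (Fin n), ℂ)).compSubConstCLM ℝ x))
    (zero_notMem_tsupport_of_norm_le (half_pos (two_zpow_pos j)) fun ξ hξ => by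
      rw [fourierInv_compSubConstCLM_fourier_apply, bandSymbol_eq_zero_of_le _ hξ, mul_zero])
    fun ξ => by
      rw [fourierInv_compSubConstCLM_fourier_apply, fourierInv_compSubConstCLM_fourier_apply,
        bandSymbol_add, mul_left_comm]
  rw [TemperedDistribution.fourier_apply, TemperedDistribution.fourier_apply,
    FourierTransform.fourier_fourierInv_eq, FourierTransform.fourier_fourierInv_eq] at key
  exact key

theorem norm_heatExtension_le_of_besovNorm_le {β : ℝ} {f : 𝓢'(EuclideanSpace ℝ (Fin n), ℂ)}
    {b : ℝ≥0} (hb : besovNorm β f ≤ b) (t : ℝ) (ht : 0 < t) (x : EuclideanSpace ℝ (Fin n)) :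
    ‖heatExtension f t ht x‖ ≤ (t ^ (β / 2))⁻¹ * b := by
  have h1 : ENNReal.ofReal (t ^ (β / 2)) * ‖heatExtension f t ht x‖ₑ ≤ b :=
    (mul_le_mul_right (le_iSup (fun x => ‖heatExtension f t ht x‖ₑ) x) _).trans
      ((le_iSup₂ (f := fun t ht => ENNReal.ofReal (t ^ (β / 2)) * ⨆ x, ‖heatExtension f t ht x‖ₑ)
        t ht).trans hb)
  rw [← ofReal_norm, ← ENNReal.ofReal_mul (by positivity), ← ENNReal.ofReal_coe_nnreal,
    ENNReal.ofReal_le_ofReal_iff (NNReal.coe_nonneg b)] at h1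
  rwa [le_inv_mul_iff₀ (by positivity)]

/-- Bernstein-type bound: the band at frequency `2 ^ j` is controlled by the heat extension at
time `4 ^ (-j)`, hence by the thermic norm. -/
theorem exists_norm_freqBand_le_besovNorm (n : ℕ) (σ β : ℝ) : ∃ C : ℝ≥0,
    ∀ (f : 𝓢'(EuclideanSpace ℝ (Fin n), ℂ)) (b : ℝ≥0), besovNorm β f ≤ b →
      ∀ (j : ℤ) (x : EuclideanSpace ℝ (Fin n)),
        ‖freqBand f σ j x‖ ≤ C * ((2 : ℝ) ^ j) ^ (σ + β) * b := by
  refine ⟨⟨∫ x, ‖𝓕 (heatQuotientSymbol n σ) x‖, integral_nonneg fun _ => norm_nonneg _⟩,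
    fun f b hb j x => ?_⟩
  have ht : (0 : ℝ) < ((2 : ℝ) ^ (-j)) ^ 2 := pow_pos (two_zpow_pos _) 2
  rw [freqBand, fourier_bandSymbol_eq_conv σ j ht, conv_compSubConstCLM]
  refine (TemperedDistribution.norm_apply_conv_le f _ _
    fun z => norm_heatExtension_le_of_besovNorm_le hb _ ht z).trans_eq ?_
  have hj := two_zpow_pos j
  have h1 : ((((2 : ℝ) ^ (-j)) ^ 2) ^ (β / 2))⁻¹ = ((2 : ℝ) ^ j) ^ β := by
    rw [← Real.rpow_natCast, ← Real.rpow_mul (two_zpow_pos _).le, zpow_neg, Real.inv_rpow hj.le,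
      inv_inv]
    congr 1
    push_cast
    ring
  rw [integral_norm_compSubConstCLM, integral_norm_fourier_dyadicSymbol, h1,
    Real.rpow_add hj]
  change _ = (∫ x, ‖𝓕 (heatQuotientSymbol n σ) x‖) * _ * _
  ring

/-- The bands of a function are dominated by its maximal function. -/
theorem exists_enorm_freqBand_le_maximalFun (n : ℕ) (σ : ℝ) : ∃ C : ℝ≥0,
    ∀ (F : 𝓢'(EuclideanSpace ℝ (Fin n), ℂ)) (g : EuclideanSpace ℝ (Fin n) → ℂ),
      IsGivenBy F g → ∀ q : EuclideanSpace ℝ (Fin n) → ℝ≥0, Measurable q →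
      (∀ᵐ x, ‖g x‖₊ = q x) → ∀ (j : ℤ) (x : EuclideanSpace ℝ (Fin n)),
        ‖freqBand F σ j x‖ₑ
          ≤ C * ENNReal.ofReal (((2 : ℝ) ^ j) ^ σ) * maximalFun (fun y => (q y : ℝ≥0∞)) x := by
  set P : 𝓢(EuclideanSpace ℝ (Fin n), ℂ) :=
    annulusSymbol (fun ξ => (2 * Real.pi * ‖ξ‖) ^ σ) (contDiffAt_norm_rpow σ) with hP
  obtain ⟨B, -, hB⟩ := exists_one_add_pow_mul_le (𝓕 P : 𝓢(EuclideanSpace ℝ (Fin n), ℂ))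
    (Module.finrank ℝ (EuclideanSpace ℝ (Fin n)) + 1) 0
  obtain ⟨C, hC⟩ := exists_lintegral_kernel_mul_le_maximalFun
    (K := (𝓕 P : 𝓢(EuclideanSpace ℝ (Fin n), ℂ))) (C := B)
    fun z => by simpa only [norm_iteratedFDeriv_zero] using hB z
  refine ⟨C, fun F g hF q hq hgq j x => ?_⟩
  have hj := two_zpow_pos j
  rw [freqBand, (hF _).2]
  refine (enorm_integral_le_lintegral_enorm _).trans ?_
  calc ∫⁻ y, ‖(𝓕 (bandSymbol (EuclideanSpace ℝ (Fin n)) σ j) :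
        𝓢(EuclideanSpace ℝ (Fin n), ℂ)).compSubConstCLM ℝ x y * g y‖ₑ
      = ∫⁻ y, ENNReal.ofReal (((2 : ℝ) ^ j) ^ σ) *
          (ENNReal.ofReal (((2 : ℝ) ^ j) ^ Module.finrank ℝ (EuclideanSpace ℝ (Fin n))) *
            ‖(𝓕 P : 𝓢(EuclideanSpace ℝ (Fin n), ℂ)) ((2 : ℝ) ^ j • (y - x))‖ₑ * q y) := by
        refine lintegral_congr_ae ?_
        filter_upwards [hgq] with y hy
        rw [compSubConstCLM_apply, bandSymbol, fourier_dyadicSymbol_apply, ← hP, ← hy, enorm_mul,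
          enorm_mul, enorm_mul, ← ofReal_norm (_ : ℂ), ← ofReal_norm (_ : ℂ), Complex.norm_real,
          Complex.norm_real, Real.norm_of_nonneg (Real.rpow_pos_of_pos hj _).le,
          Real.norm_of_nonneg (pow_pos hj _).le, mul_assoc, mul_assoc, mul_assoc]
        rfl
    _ = ENNReal.ofReal (((2 : ℝ) ^ j) ^ σ) * ∫⁻ y,
          ENNReal.ofReal (((2 : ℝ) ^ j) ^ Module.finrank ℝ (EuclideanSpace ℝ (Fin n))) *
            ‖(𝓕 P : 𝓢(EuclideanSpace ℝ (Fin n), ℂ)) ((2 : ℝ) ^ j • (y - x))‖ₑ * q y :=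
        lintegral_const_mul' _ _ ENNReal.ofReal_ne_top
    _ ≤ ENNReal.ofReal (((2 : ℝ) ^ j) ^ σ) * (C * maximalFun (fun y => (q y : ℝ≥0∞)) x) := by
        gcongr
        exact hC _ hq.coe_nnreal_ennreal _ hj x
    _ = _ := by ring

end Band

/-! ### Hedberg's summation of the frequency bands -/

/-- Interpolation by summing the smaller of two geometric progressions over the dyadic scales. The
sum is split at the scale where the two progressions cross. -/
theorem exists_tsum_dyadic_le {p r : ℝ} (hp : 0 < p) (hr : 0 < r) : ∃ K : ℝ≥0,
    ∀ (a : ℤ → ℝ≥0∞) (b M : ℝ≥0), 0 < b →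
      (∀ j, a j ≤ ENNReal.ofReal (((2 : ℝ) ^ j) ^ p) * b) →
      (∀ j, a j ≤ ENNReal.ofReal (((2 : ℝ) ^ j) ^ (-r)) * M) →
      ∑' j, a j ≤ K * (M : ℝ≥0∞) ^ (p / (p + r)) * (b : ℝ≥0∞) ^ (r / (p + r)) := by
  have hlt : ∀ t : ℝ, 0 < t → ENNReal.ofReal (2 ^ (-t)) < 1 := fun t ht => by
    rw [ENNReal.ofReal_lt_one]
    exact Real.rpow_lt_one_of_one_lt_of_neg one_lt_two (neg_lt_zero.2 ht)
  have hne : ∀ t : ℝ, 0 < t → (1 - ENNReal.ofReal (2 ^ (-t)))⁻¹ ≠ ⊤ := fun t ht =>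
    ENNReal.inv_ne_top.2 (tsub_pos_of_lt (hlt t ht)).ne'
  have hpr : 0 < p + r := add_pos hp hr
  refine ⟨((1 - ENNReal.ofReal (2 ^ (-r)))⁻¹ + (1 - ENNReal.ofReal (2 ^ (-p)))⁻¹).toNNReal,
    fun a b M hb h₁ h₂ => ?_⟩
  rcases eq_or_ne M 0 with rfl | hM0
  · have : ∀ j, a j = 0 := fun j => by simpa using h₂ j
    simp [this]
  have hM : 0 < M := pos_iff_ne_zero.2 hM0
  -- the crossing scale
  set ρ : ℝ := ((M : ℝ) / b) ^ (p + r)⁻¹ with hρ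
  have hMb : (0 : ℝ) < (M : ℝ) / b := by positivity
  have hρ0 : 0 < ρ := Real.rpow_pos_of_pos hMb _
  obtain ⟨J, hJ1, hJ2⟩ := exists_mem_Ico_zpow hρ0 one_lt_two
  have hX1 : ρ ^ p * b = (M : ℝ) ^ (p / (p + r)) * (b : ℝ) ^ (r / (p + r)) := by
    rw [hρ, ← Real.rpow_mul hMb.le, inv_mul_eq_div, Real.div_rpow M.coe_nonneg b.coe_nonneg, div_mul_eq_mul_div,
      mul_div_assoc]
    congr 1
    have : r / (p + r) = 1 - p / (p + r) := by field_simp; ring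
    rw [this, Real.rpow_sub (by exact_mod_cast hb), Real.rpow_one]
  have hX2 : ρ ^ (-r) * M = (M : ℝ) ^ (p / (p + r)) * (b : ℝ) ^ (r / (p + r)) := by
    have : ρ ^ (p + r) = (M : ℝ) / b := by
      rw [hρ, ← Real.rpow_mul hMb.le, inv_mul_cancel₀ hpr.ne', Real.rpow_one]
    have h3 : (M : ℝ) = ρ ^ (p + r) * b := by rw [this]; field_simp
    rw [← hX1, h3, ← mul_assoc, ← Real.rpow_add hρ0]
    congr 2
    ring
  set X : ℝ := (M : ℝ) ^ (p / (p + r)) * (b : ℝ) ^ (r / (p + r)) with hX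
  have hstep : ∀ (k : ℤ) (i : ℕ) (t : ℝ),
      (((2 : ℝ) ^ (k + i)) ^ t) = ((2 : ℝ) ^ k) ^ t * (2 ^ t) ^ i := fun k i t => by
      rw [zpow_add₀ two_ne_zero, Real.mul_rpow (two_zpow_pos _).le (two_zpow_pos _).le, zpow_natCast,
        ← Real.rpow_natCast 2, ← Real.rpow_natCast (2 ^ t), ← Real.rpow_mul two_pos.le,
        ← Real.rpow_mul two_pos.le, mul_comm t]
  have hstep' : ∀ (k : ℤ) (i : ℕ) (t : ℝ),
      (((2 : ℝ) ^ (k - i)) ^ t) = ((2 : ℝ) ^ k) ^ t * (2 ^ (-t)) ^ i := fun k i t => by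
      rw [zpow_sub₀ two_ne_zero, Real.div_rpow (two_zpow_pos _).le (two_zpow_pos _).le, zpow_natCast,
        ← Real.rpow_natCast 2, ← Real.rpow_natCast (2 ^ (-t)), ← Real.rpow_mul two_pos.le,
        ← Real.rpow_mul two_pos.le, div_eq_mul_inv, ← Real.rpow_neg two_pos.le, neg_mul, mul_comm t]
  have hsum := ENNReal.tsum_int_le_of_geometric (f := a) J (a := ENNReal.ofReal X)
    (c := ENNReal.ofReal X) (r₁ := ENNReal.ofReal (2 ^ (-p))) (r₂ := ENNReal.ofReal (2 ^ (-r)))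
    (fun i => by
      refine (h₁ _).trans ?_
      rw [← ENNReal.ofReal_coe_nnreal, ← ENNReal.ofReal_mul (by positivity),
        ← ENNReal.ofReal_pow (by positivity), ← ENNReal.ofReal_mul (by positivity), hstep', ← hX1]
      refine ENNReal.ofReal_le_ofReal ?_
      rw [mul_right_comm]
      gcongr)
    (fun i => by
      refine (h₂ _).trans ?_
      rw [← ENNReal.ofReal_coe_nnreal, ← ENNReal.ofReal_mul (by positivity),
        ← ENNReal.ofReal_pow (by positivity), ← ENNReal.ofReal_mul (by positivity), hstep, ← hX2]
      refine ENNReal.ofReal_le_ofReal ?_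
      rw [mul_right_comm]
      gcongr ?_ * _ * _
      exact Real.rpow_le_rpow_of_nonpos hρ0 hJ2.le (neg_nonpos.2 hr.le))
  refine hsum.trans_eq ?_
  rw [ENNReal.coe_toNNReal (ENNReal.add_ne_top.2 ⟨hne r hr, hne p hp⟩), ← mul_add, mul_comm,
    mul_assoc, hX, ENNReal.ofReal_mul (by positivity),
    ← ENNReal.ofReal_rpow_of_pos (NNReal.coe_pos.2 hM),
    ← ENNReal.ofReal_rpow_of_pos (NNReal.coe_pos.2 hb), ENNReal.ofReal_coe_nnreal,
    ENNReal.ofReal_coe_nnreal]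

/-- Pointwise interpolation: the sum of the frequency bands of `(-Δ)^{s₁/2} f` is dominated by a
product of powers of the maximal function of `(-Δ)^{s/2} f` and of the thermic norm of `f`. -/
theorem exists_tsum_enorm_freqBand_le (n : ℕ) {s s₁ β θ : ℝ} (hs₁ : 0 ≤ s₁) (hs : s₁ < s)
    (hβ : 0 < β) (hθ : θ = (s - s₁) / (β + s)) : ∃ C : ℝ≥0,
    ∀ (f F : 𝓢'(EuclideanSpace ℝ (Fin n), ℂ)) (g : EuclideanSpace ℝ (Fin n) → ℂ),
      IsFracLaplacian s f F → IsGivenBy F g →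
      ∀ q : EuclideanSpace ℝ (Fin n) → ℝ≥0, Measurable q → (∀ᵐ x, ‖g x‖₊ = q x) →
      ∀ b : ℝ≥0, 0 < b → besovNorm β f ≤ b → ∀ x, maximalFun (fun y => (q y : ℝ≥0∞)) x < ⊤ →
        ∑' j, ‖freqBand f s₁ j x‖ₑ
          ≤ C * maximalFun (fun y => (q y : ℝ≥0∞)) x ^ (1 - θ) * (b : ℝ≥0∞) ^ θ := by
  obtain ⟨C₁, h₁⟩ := exists_norm_freqBand_le_besovNorm n s₁ β
  obtain ⟨C₂, h₂⟩ := exists_enorm_freqBand_le_maximalFun n (s₁ - s)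
  obtain ⟨K, hK⟩ := exists_tsum_dyadic_le (p := s₁ + β) (r := s - s₁) (by linarith) (by linarith)
  have hθ' : (s - s₁) / (s₁ + β + (s - s₁)) = θ := by rw [hθ]; congr 1; ring
  have hθ'' : (s₁ + β) / (s₁ + β + (s - s₁)) = 1 - θ := by
    rw [hθ, eq_sub_iff_add_eq, show s₁ + β + (s - s₁) = β + s by ring, ← add_div,
      show s₁ + β + (s - s₁) = β + s by ring, div_self (by linarith)]
  rw [hθ', hθ''] at hK
  have hθ0 : 0 ≤ θ := by rw [hθ]; exact div_nonneg (by linarith) (by linarith)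
  have hθ1 : 0 ≤ 1 - θ := by rw [← hθ'']; exact div_nonneg (by linarith) (by linarith)
  refine ⟨K * (C₁ + C₂ + 1), fun f F g hF hg q hq hgq b hb hfb x hx => ?_⟩
  have hD : C₁ + C₂ + 1 ≠ 0 := by positivity
  set D : ℝ≥0 := C₁ + C₂ + 1
  lift maximalFun (fun y => (q y : ℝ≥0∞)) x to ℝ≥0 using hx.ne with M hM
  refine (hK (fun j => ‖freqBand f s₁ j x‖ₑ) (D * b) (D * M) (by positivity) (fun j => ?_)
    fun j => ?_).trans_eq ?_
  · have := ENNReal.ofReal_le_ofReal (h₁ f b hfb j x)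
    rw [ofReal_norm] at this
    refine this.trans ?_
    rw [ENNReal.ofReal_mul (by positivity), ENNReal.ofReal_mul (by positivity),
      ENNReal.ofReal_coe_nnreal, ENNReal.ofReal_coe_nnreal, ENNReal.coe_mul, mul_comm (C₁ : ℝ≥0∞),
      mul_assoc]
    gcongr
    exact (le_add_right le_rfl).trans (le_add_right le_rfl)
  · have := h₂ F g hg q hq hgq j x
    rw [hF.freqBand_eq, sub_add_cancel, ← hM] at this
    refine this.trans ?_
    rw [neg_sub, ENNReal.coe_mul, mul_comm (C₂ : ℝ≥0∞), mul_assoc]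
    gcongr
    exact (le_add_left le_rfl).trans (le_add_right le_rfl)
  · rw [ENNReal.coe_mul, ENNReal.coe_mul, ENNReal.mul_rpow_of_nonneg _ _ hθ1,
      ENNReal.mul_rpow_of_nonneg _ _ hθ0, ENNReal.coe_mul]
    have : (D : ℝ≥0∞) ^ (1 - θ) * (D : ℝ≥0∞) ^ θ = D := by
      rw [← ENNReal.rpow_add _ _ (by exact_mod_cast hD) ENNReal.coe_ne_top, sub_add_cancel,
        ENNReal.rpow_one]
    calc _ = (K : ℝ≥0∞) * ((D : ℝ≥0∞) ^ (1 - θ) * (D : ℝ≥0∞) ^ θ) * (M : ℝ≥0∞) ^ (1 - θ)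
          * (b : ℝ≥0∞) ^ θ := by ring
      _ = _ := by rw [this]

/-! ### Tempered distributions given by series of functions -/

section GivenBy

variable {n : ℕ}

theorem IsGivenBy.congr_ae {G : 𝓢'(EuclideanSpace ℝ (Fin n), ℂ)}
    {g g' : EuclideanSpace ℝ (Fin n) → ℂ} (hG : IsGivenBy G g) (h : g =ᵐ[volume] g') :
    IsGivenBy G g' := fun φ => by
  have h' : (fun x => φ x * g x) =ᵐ[volume] fun x => φ x * g' x := by
    filter_upwards [h] with x hx
    rw [hx]
  exact ⟨(hG φ).1.congr h', (hG φ).2.trans (integral_congr_ae h')⟩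

/-- A function bounded by the sum of a constant and an integrable function is integrable against
Schwartz functions. -/
theorem lintegral_enorm_schwartz_mul_lt_top (φ : 𝓢(EuclideanSpace ℝ (Fin n), ℂ)) {a : ℝ≥0}
    {h w : EuclideanSpace ℝ (Fin n) → ℝ≥0∞} (hh : ∫⁻ x, h x ≠ ⊤) (hw : ∀ᵐ x, w x ≤ a + h x) :
    ∫⁻ x, ‖φ x‖ₑ * w x < ⊤ := by
  obtain ⟨B, hB0, hB⟩ := exists_one_add_pow_mul_le φ 0 0
  have hφ : ∫⁻ x, ‖φ x‖ₑ < ⊤ := φ.integrable.2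
  calc ∫⁻ x, ‖φ x‖ₑ * w x ≤ ∫⁻ x, (‖φ x‖ₑ * a + ENNReal.ofReal B * h x) := by
        refine lintegral_mono_ae ?_
        filter_upwards [hw] with x hx
        refine (mul_le_mul_right hx _).trans ?_
        rw [mul_add]
        gcongr
        rw [← ofReal_norm]
        refine ENNReal.ofReal_le_ofReal ?_
        simpa using hB x
    _ = (∫⁻ x, ‖φ x‖ₑ * a) + ∫⁻ x, ENNReal.ofReal B * h x :=
        lintegral_add_left (φ.continuous.enorm.measurable.mul_const _) _
    _ < ⊤ := by
        rw [lintegral_mul_const' _ _ ENNReal.coe_ne_top,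
          lintegral_const_mul' _ _ ENNReal.ofReal_ne_top]
        exact ENNReal.add_lt_top.2 ⟨ENNReal.mul_lt_top hφ ENNReal.coe_lt_top,
          ENNReal.mul_lt_top ENNReal.ofReal_lt_top hh.lt_top⟩

/-- A function bounded by the sum of a constant and an integrable function is the sum of a bounded
function and an integrable one, so it defines a tempered distribution. -/
theorem exists_isGivenBy {g : EuclideanSpace ℝ (Fin n) → ℂ} (hg : AEStronglyMeasurable g volume)
    {a : ℝ≥0} {h : EuclideanSpace ℝ (Fin n) → ℝ≥0∞} (hh : ∫⁻ x, h x ≠ ⊤)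
    (hgh : ∀ᵐ x, ‖g x‖ₑ ≤ a + h x) :
    ∃ G : 𝓢'(EuclideanSpace ℝ (Fin n), ℂ), IsGivenBy G g := by
  suffices H : ∃ G : 𝓢'(EuclideanSpace ℝ (Fin n), ℂ), IsGivenBy G (hg.mk g) by
    obtain ⟨G, hG⟩ := H
    exact ⟨G, hG.congr_ae hg.ae_eq_mk.symm⟩
  have hm : StronglyMeasurable (hg.mk g) := hg.stronglyMeasurable_mk
  have hgh' : ∀ᵐ x, ‖hg.mk g x‖ₑ ≤ a + h x := by
    filter_upwards [hgh, hg.ae_eq_mk] with x hx hx'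
    rwa [← hx']
  set g' := hg.mk g
  -- where `‖g'‖ > 2 a`, the hypothesis gives `‖g'‖ ≤ 2 h`
  set S : Set (EuclideanSpace ℝ (Fin n)) := {x | ‖g' x‖ₑ ≤ 2 * a} with hS
  have hSm : MeasurableSet S := measurableSet_le hm.enorm measurable_const
  have h1 : MemLp (S.indicator g') ⊤ volume := by
    refine memLp_top_of_bound (hm.indicator hSm).aestronglyMeasurable (2 * a : ℝ≥0)
      (ae_of_all _ fun x => ?_)
    by_cases hx : x ∈ S
    · rw [Set.indicator_of_mem hx, ← coe_nnnorm, NNReal.coe_le_coe]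
      have hx' : ‖g' x‖ₑ ≤ 2 * a := hx
      exact_mod_cast hx'
    · rw [Set.indicator_of_notMem hx, norm_zero]
      exact NNReal.coe_nonneg _
  have h2 : MemLp (Sᶜ.indicator g') 1 volume := by
    rw [memLp_one_iff_integrable]
    refine ⟨(hm.indicator hSm.compl).aestronglyMeasurable, ?_⟩
    refine lt_of_le_of_lt (lintegral_mono_ae (g := fun x => 2 * h x) ?_) ?_
    · filter_upwards [hgh'] with x hx
      by_cases hxS : x ∈ S
      · rw [Set.indicator_of_notMem (by simpa using hxS), enorm_zero]
        exact zero_le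
      · rw [Set.indicator_of_mem hxS]
        have hlt : 2 * (a : ℝ≥0∞) < ‖g' x‖ₑ := not_le.1 hxS
        have : ‖g' x‖ₑ + ‖g' x‖ₑ ≤ ‖g' x‖ₑ + 2 * h x := by
          calc ‖g' x‖ₑ + ‖g' x‖ₑ = 2 * ‖g' x‖ₑ := (two_mul _).symm
            _ ≤ 2 * (a + h x) := by gcongr
            _ = 2 * a + 2 * h x := mul_add _ _ _
            _ ≤ _ := by gcongr
        exact (ENNReal.add_le_add_iff_left enorm_ne_top).1 this
    · rw [lintegral_const_mul' _ _ ENNReal.ofNat_ne_top]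
      exact ENNReal.mul_lt_top ENNReal.ofNat_lt_top hh.lt_top
  have : Fact ((1 : ℝ≥0∞) ≤ ⊤) := ⟨le_top⟩
  have hint : ∀ φ : 𝓢(EuclideanSpace ℝ (Fin n), ℂ), ∀ T : Set (EuclideanSpace ℝ (Fin n)),
      MeasurableSet T → Integrable (fun x => φ x * T.indicator g' x) volume := fun φ T hT => by
    refine ⟨(φ.continuous.aestronglyMeasurable).mul (hm.indicator hT).aestronglyMeasurable, ?_⟩
    have := lintegral_enorm_schwartz_mul_lt_top φ hh hgh'
    refine lt_of_le_of_lt (lintegral_mono fun x => ?_) this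
    rw [enorm_mul]
    gcongr
    exact enorm_indicator_le_enorm_self _ _
  refine ⟨Lp.toTemperedDistribution h1.toLp + Lp.toTemperedDistribution h2.toLp,
    fun φ => ⟨by simpa using hint φ Set.univ MeasurableSet.univ, ?_⟩⟩
  change Lp.toTemperedDistribution h1.toLp φ + Lp.toTemperedDistribution h2.toLp φ = _
  rw [Lp.toTemperedDistribution_apply, Lp.toTemperedDistribution_apply]
  have e1 : ∫ x, φ x • (h1.toLp : EuclideanSpace ℝ (Fin n) → ℂ) x
      = ∫ x, φ x * S.indicator g' x := by
    refine integral_congr_ae ?_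
    filter_upwards [h1.coeFn_toLp] with x hx
    rw [hx, smul_eq_mul]
  have e2 : ∫ x, φ x • (h2.toLp : EuclideanSpace ℝ (Fin n) → ℂ) x
      = ∫ x, φ x * Sᶜ.indicator g' x := by
    refine integral_congr_ae ?_
    filter_upwards [h2.coeFn_toLp] with x hx
    rw [hx, smul_eq_mul]
  rw [e1, e2, ← integral_add (hint φ S hSm) (hint φ Sᶜ hSm.compl)]
  congr 1
  ext x
  rw [← mul_add, ← Pi.add_apply (S.indicator g'), Set.indicator_self_add_compl]

/-- A series of functions that converges absolutely almost everywhere, with the sum of the moduli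
bounded by a constant plus an integrable function, converges in the sense of tempered
distributions. -/
theorem exists_isGivenBy_tsum {u : ℤ → EuclideanSpace ℝ (Fin n) → ℂ} (hu : ∀ j, Continuous (u j))
    {a : ℝ≥0} {h : EuclideanSpace ℝ (Fin n) → ℝ≥0∞} (hh : ∫⁻ x, h x ≠ ⊤)
    (hfin : ∀ᵐ x, ∑' j, ‖u j x‖ₑ < ⊤) (huh : ∀ᵐ x, ∑' j, ‖u j x‖ₑ ≤ a + h x) :
    AEStronglyMeasurable (fun x => ∑' j, u j x) volume ∧
    (∀ᵐ x, ‖∑' j, u j x‖ₑ ≤ ∑' j, ‖u j x‖ₑ) ∧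
    ∃ G : 𝓢'(EuclideanSpace ℝ (Fin n), ℂ), IsGivenBy G (fun x => ∑' j, u j x) ∧
      ∀ φ : 𝓢(EuclideanSpace ℝ (Fin n), ℂ), HasSum (fun j => ∫ x, φ x * u j x) (G φ) := by
  have hsum : ∀ᵐ x, Summable fun j => u j x := by
    filter_upwards [hfin] with x hx
    refine Summable.of_nnnorm (ENNReal.tsum_coe_ne_top_iff_summable.1 hx.ne)
  have hmeas : AEStronglyMeasurable (fun x => ∑' j, u j x) volume := by
    refine aestronglyMeasurable_of_tendsto_ae (atTop : Filter (Finset ℤ))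
      (f := fun s x => ∑ j ∈ s, u j x)
      (fun s => (continuous_finsetSum s fun j _ => hu j).aestronglyMeasurable) ?_
    filter_upwards [hsum] with x hx
    exact hx.hasSum
  have hle : ∀ᵐ x, ‖∑' j, u j x‖ₑ ≤ ∑' j, ‖u j x‖ₑ := by
    filter_upwards [hfin] with x hx
    exact enorm_tsum_le_tsum_enorm
  obtain ⟨G, hG⟩ := exists_isGivenBy hmeas hh (by
    filter_upwards [hle, huh] with x h1 h2
    exact h1.trans h2)
  refine ⟨hmeas, hle, G, hG, fun φ => ?_⟩
  have hlt := lintegral_enorm_schwartz_mul_lt_top φ hh huh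
  simp only [← ENNReal.tsum_mul_left, ← enorm_mul] at hlt
  have hmeas' : ∀ j, AEStronglyMeasurable (fun x => φ x * u j x) volume := fun j =>
    (φ.continuous.mul (hu j)).aestronglyMeasurable
  rw [lintegral_tsum fun j => (hmeas' j).enorm] at hlt
  have hint : ∀ j, Integrable (fun x => φ x * u j x) volume := fun j =>
    ⟨hmeas' j, (ENNReal.le_tsum j).trans_lt hlt⟩
  have hs : Summable fun j => ∫ x, ‖φ x * u j x‖ := by
    simp only [integral_norm_eq_lintegral_enorm (hmeas' _)]
    exact ENNReal.summable_toReal hlt.ne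
  have := hasSum_integral_of_summable_integral_norm hint hs
  rw [(hG φ).2]
  simpa only [tsum_mul_left] using this

end GivenBy

/-! ### The series of the frequency bands is the fractional Laplacian -/

section FracLaplacian

variable {n : ℕ}

/-- Away from the zero frequency, the series of the bands has the right Fourier transform: the
cutoffs form a partition of unity. -/
theorem fourier_eq_of_hasSum_freqBand {σ : ℝ} {f G : 𝓢'(EuclideanSpace ℝ (Fin n), ℂ)}
    (hG : ∀ φ : 𝓢(EuclideanSpace ℝ (Fin n), ℂ),
      HasSum (fun j => ∫ x, φ x * freqBand f σ j x) (G φ))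
    {φ ψ : 𝓢(EuclideanSpace ℝ (Fin n), ℂ)} (hφ : (0 : EuclideanSpace ℝ (Fin n)) ∉ tsupport φ)
    (hψ : ∀ ξ, ψ ξ = (((2 * Real.pi * ‖ξ‖) ^ σ : ℝ) : ℂ) * φ ξ) : 𝓕 G φ = 𝓕 f ψ := by
  rw [TemperedDistribution.fourier_apply, TemperedDistribution.fourier_apply]
  have h1 := (hG (𝓕 φ)).comp tendsto_dyadicBlock
  -- the partial sums over symmetric blocks are obtained by a cutoff to a large ball
  obtain ⟨r, hr, hr0⟩ : ∃ r > 0, ∀ ξ, ‖ξ‖ < r → φ ξ = 0 := by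
    rw [notMem_tsupport_iff_eventuallyEq] at hφ
    obtain ⟨r, hr, h⟩ := Metric.eventually_nhds_iff.1 hφ
    exact ⟨r, hr, fun ξ hξ => h (by rwa [dist_zero_right])⟩
  have hc : Tendsto (fun N : ℕ => (2 : ℝ) ^ (1 - (N : ℤ))) atTop (𝓝 0) := by
    have h2 := (tendsto_pow_atTop_nhds_zero_of_lt_one (r := (1 / 2 : ℝ)) (by norm_num)
      (by norm_num)).const_mul 2
    rw [mul_zero] at h2
    refine h2.congr fun N => ?_
    rw [zpow_sub₀ two_ne_zero, zpow_one, zpow_natCast, one_div, inv_pow, div_eq_mul_inv]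
  have h3 := tendsto_smulLeftCLM_lpBump ψ (fun N => (two_zpow_pos (1 - (N : ℤ))).le) hc
  have h4 : Tendsto (fun N : ℕ => f (𝓕 (smulLeftCLM ℂ
      (fun ξ : EuclideanSpace ℝ (Fin n) =>
        ((lpBump (EuclideanSpace ℝ (Fin n)) ((2 : ℝ) ^ (1 - (N : ℤ)) • ξ) : ℝ) : ℂ)) ψ)))
      atTop (𝓝 (f (𝓕 ψ))) :=
    ((f.continuous.comp (FourierTransform.continuous_fourier)).tendsto _).comp h3
  refine tendsto_nhds_unique h1 (h4.congr' ?_)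
  have hlarge : ∀ᶠ N : ℕ in atTop, 2 ≤ (2 : ℝ) ^ (1 + (N : ℤ)) * r := by
    have : Tendsto (fun N : ℕ => 2 * (2 : ℝ) ^ N * r) atTop atTop :=
      ((tendsto_pow_atTop_atTop_of_one_lt one_lt_two).const_mul_atTop two_pos).atTop_mul_const hr
    filter_upwards [this.eventually_ge_atTop 2] with N hN
    rwa [zpow_one_add₀ two_ne_zero, zpow_natCast]
  filter_upwards [hlarge] with N hN
  simp only [Function.comp_apply, integral_mul_freqBand, FourierTransform.fourierInv_fourier_eq]
  rw [← map_sum, ← FourierTransform.fourier_sum]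
  congr 2
  ext ξ
  rw [smulLeftCLM_apply_apply (hasTemperateGrowth_lpBump_smul _), _root_.sum_apply]
  simp only [smulLeftCLM_apply_apply (SchwartzMap.hasTemperateGrowth _), smul_eq_mul,
    bandSymbol_apply, Complex.ofReal_mul]
  have h5 := sum_dyadicBlock_lpCutoff N ξ
  rw [hψ]
  rcases lt_or_ge ‖ξ‖ r with h | h
  · simp [hr0 ξ h]
  · rw [lpBump_eq_zero (ξ := (2 : ℝ) ^ (1 + (N : ℤ)) • ξ), sub_zero] at h5
    · rw [← h5, ← Finset.sum_mul, ← Finset.mul_sum, Complex.ofReal_sum]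
      ring
    · rw [norm_smul, Real.norm_of_nonneg (two_zpow_pos _).le]
      exact hN.trans (by gcongr)

/-- Young's inequality for the frequency truncations, uniformly in the truncation scale. -/
theorem integral_norm_fourier_smulLeftCLM_dilate_le (P u : 𝓢(EuclideanSpace ℝ (Fin n), ℂ))
    (R : ℝ) (hR : 0 < R) :
    ∫ x, ‖𝓕 (smulLeftCLM ℂ (dilate R hR.ne' P) (𝓕⁻ u)) x‖
      ≤ (∫ x, ‖𝓕 P x‖) * ∫ x, ‖u x‖ := by
  rw [← conv_fourier]
  refine (integral_norm_conv_le _ _).trans_eq ?_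
  congr 1
  simp only [fourier_dilate_apply, norm_mul, Complex.norm_real, Real.norm_eq_abs, abs_abs]
  rw [integral_const_mul, integral_norm_dilate _ (inv_pos.2 hR), inv_pow, inv_inv,
    abs_of_pos (inv_pos.2 (pow_pos hR _)), inv_mul_cancel_left₀ (pow_pos hR _).ne']

/-- The series of the bands has no component at frequency zero: a truncation to frequencies
`O (1 / R)` only meets the bands with `2 ^ j = O (1 / R)`, whose sum is small since the band `j` is
`O (2 ^ (j p))` for some `p > 0`. -/
theorem vanishesAtZeroFrequency_of_hasSum_freqBand {σ p : ℝ} (hp : 0 < p)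
    {f G : 𝓢'(EuclideanSpace ℝ (Fin n), ℂ)}
    (hG : ∀ φ : 𝓢(EuclideanSpace ℝ (Fin n), ℂ),
      HasSum (fun j => ∫ x, φ x * freqBand f σ j x) (G φ))
    {B : ℝ≥0} (hB : ∀ j x, ‖freqBand f σ j x‖ ≤ B * ((2 : ℝ) ^ j) ^ p) :
    VanishesAtZeroFrequency G := by
  intro χ hχ hχs
  obtain ⟨ρ, hρ, hρχ⟩ : ∃ ρ : ℝ, 0 < ρ ∧ ∀ ξ, ρ ≤ ‖ξ‖ → χ ξ = 0 := by
    obtain ⟨ρ, hρ⟩ := hχs.isCompact.isBounded.subset_closedBall (0 : EuclideanSpace ℝ (Fin n))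
    refine ⟨max ρ 0 + 1, by positivity, fun ξ hξ => image_eq_zero_of_notMem_tsupport fun h => ?_⟩
    have := mem_closedBall_zero_iff.1 (hρ h)
    have := le_max_left ρ 0
    linarith
  set P : 𝓢(EuclideanSpace ℝ (Fin n), ℂ) := hχs.toSchwartzMap hχ with hP
  rw [PointwiseConvergenceCLM.tendsto_iff_forall_tendsto]
  intro u
  -- a band `j` met by the truncation has `2 ^ j < 2 ρ / R`, so that the bound `2 ^ (j p)` is at most
  -- `2 ^ (-j) (2 ρ / R) ^ (p + 1)`, and the two progressions can be interpolated
  obtain ⟨K, hK⟩ := exists_tsum_dyadic_le hp one_pos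
  obtain ⟨I, hI⟩ : ∃ I : ℝ≥0, (I : ℝ) = (∫ x, ‖𝓕 P x‖) * ∫ x, ‖u x‖ :=
    ⟨⟨_, mul_nonneg (integral_nonneg fun _ => norm_nonneg _)
      (integral_nonneg fun _ => norm_nonneg _)⟩, rfl⟩
  set D : ℝ≥0 := B * I + 1 with hD
  have key : ∀ R : ℝ, 0 < R →
      ‖TemperedDistribution.fourierMultiplierCLM ℂ (fun ξ => χ (R • ξ)) G u‖ₑ
        ≤ K * ((D * (2 * ρ / R).toNNReal ^ (p + 1) : ℝ≥0) : ℝ≥0∞) ^ (p / (p + 1))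
          * (D : ℝ≥0∞) ^ (1 / (p + 1)) := by
    intro R hR
    set Φ : 𝓢(EuclideanSpace ℝ (Fin n), ℂ) := 𝓕 (smulLeftCLM ℂ (dilate R hR.ne' P) (𝓕⁻ u)) with hΦ
    change ‖G Φ‖ₑ ≤ _
    rw [← (hG Φ).tsum_eq]
    refine enorm_tsum_le_tsum_enorm.trans ?_
    have hj : ∀ j, ‖∫ x, Φ x * freqBand f σ j x‖ ≤ ((2 : ℝ) ^ j) ^ p * D := fun j => by
      have hint : Integrable (fun x => ‖Φ x‖ * (B * ((2 : ℝ) ^ j) ^ p)) volume :=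
        Φ.integrable.norm.mul_const _
      calc _ ≤ ∫ x, ‖Φ x‖ * (B * ((2 : ℝ) ^ j) ^ p) := by
            refine norm_integral_le_of_norm_le hint (ae_of_all _ fun x => ?_)
            rw [norm_mul]
            gcongr
            exact hB j x
        _ = (∫ x, ‖Φ x‖) * (B * ((2 : ℝ) ^ j) ^ p) := integral_mul_const _ _
        _ ≤ ((∫ x, ‖𝓕 P x‖) * ∫ x, ‖u x‖) * (B * ((2 : ℝ) ^ j) ^ p) := by
            gcongr
            exact integral_norm_fourier_smulLeftCLM_dilate_le P u R hR
        _ = ((2 : ℝ) ^ j) ^ p * (B * ((∫ x, ‖𝓕 P x‖) * ∫ x, ‖u x‖)) := by ring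
        _ ≤ ((2 : ℝ) ^ j) ^ p * D := by
            gcongr
            rw [hD, NNReal.coe_add, NNReal.coe_mul, hI]
            exact le_add_of_nonneg_right zero_le_one
    refine hK _ _ _ (by positivity) (fun j => ?_) fun j => ?_
    · rw [← ofReal_norm, ← ENNReal.ofReal_coe_nnreal, ← ENNReal.ofReal_mul (by positivity)]
      exact ENNReal.ofReal_le_ofReal (hj j)
    · rcases le_or_gt (2 * ρ / R) (2 ^ j) with h | h
      · -- the truncation does not meet this band
        have hzero : smulLeftCLM ℂ (bandSymbol (EuclideanSpace ℝ (Fin n)) σ j) (𝓕⁻ Φ) = 0 := by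
          ext ξ
          rw [hΦ, FourierTransform.fourierInv_fourier_eq,
            smulLeftCLM_apply_apply (SchwartzMap.hasTemperateGrowth _),
            smulLeftCLM_apply_apply (SchwartzMap.hasTemperateGrowth _), dilate_apply, zero_apply]
          rcases le_total ‖ξ‖ (2 ^ j / 2) with h' | h'
          · rw [bandSymbol_eq_zero_of_le _ h', zero_smul]
          · have : P (R • ξ) = 0 := by
              refine hρχ _ ?_
              rw [norm_smul, Real.norm_of_nonneg hR.le]
              rw [div_le_iff₀ hR] at h
              nlinarith
            rw [this, zero_smul, smul_zero]
        rw [integral_mul_freqBand, hzero, FourierTransform.fourier_zero, map_zero, enorm_zero]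
        exact zero_le
      · rw [← ofReal_norm, ← ENNReal.ofReal_coe_nnreal, ← ENNReal.ofReal_mul (by positivity)]
        refine ENNReal.ofReal_le_ofReal ((hj j).trans ?_)
        have h2 := two_zpow_pos j
        have h3 : ((2 : ℝ) ^ j) ^ p = ((2 : ℝ) ^ j) ^ (-1 : ℝ) * ((2 : ℝ) ^ j) ^ (p + 1) := by
          rw [← Real.rpow_add h2]; congr 1; ring
        rw [NNReal.coe_mul, NNReal.coe_rpow, Real.coe_toNNReal _ (by positivity), h3,
          mul_assoc, mul_comm (((2 : ℝ) ^ j) ^ (p + 1))]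
        gcongr
  have hlim : Tendsto (fun R : ℝ =>
      K * ((D * (2 * ρ / R).toNNReal ^ (p + 1) : ℝ≥0) : ℝ≥0∞) ^ (p / (p + 1))
          * (D : ℝ≥0∞) ^ (1 / (p + 1))) atTop (𝓝 0) := by
    have h1 : Tendsto (fun R : ℝ => D * (2 * ρ / R).toNNReal ^ (p + 1)) atTop (𝓝 0) := by
      have h2 : Tendsto (fun R : ℝ => (2 * ρ / R).toNNReal) atTop (𝓝 0) := by
        have := (continuous_real_toNNReal.tendsto 0).comp
          ((tendsto_const_nhds (x := 2 * ρ)).div_atTop tendsto_id)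
        rwa [Real.toNNReal_zero] at this
      have h3 := ((NNReal.continuous_rpow_const (y := p + 1) (by positivity)).tendsto 0).comp h2
      rw [NNReal.zero_rpow (by positivity)] at h3
      simpa using h3.const_mul D
    have h4 := (((ENNReal.continuous_rpow_const (y := p / (p + 1))).tendsto _).comp
      (ENNReal.tendsto_coe.2 h1))
    rw [ENNReal.coe_zero, ENNReal.zero_rpow_of_pos (by positivity)] at h4
    have h5 := ENNReal.Tendsto.mul_const (b := (D : ℝ≥0∞) ^ (1 / (p + 1)))
      (ENNReal.Tendsto.const_mul (a := (K : ℝ≥0∞)) h4 (Or.inr ENNReal.coe_ne_top))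
      (Or.inr (ENNReal.rpow_ne_top_of_nonneg (by positivity) ENNReal.coe_ne_top))
    simpa using h5
  refine tendsto_zero_iff_enorm_tendsto_zero.2 ?_
  refine tendsto_of_tendsto_of_tendsto_of_le_of_le' tendsto_const_nhds hlim
    (Eventually.of_forall fun _ => zero_le) ?_
  filter_upwards [eventually_gt_atTop 0] with R hR
  exact key R hR

end FracLaplacian

/-! ### Orlicz bounds -/

section Orlicz

variable {n : ℕ} {A : ℝ≥0 → ℝ≥0}

theorem rescale_monotone (hA : Monotone A) {κ : ℝ} (hκ : 0 ≤ κ) : Monotone (rescale A κ) :=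
  fun _ _ h => hA (NNReal.rpow_le_rpow h hκ)

/-- A Young function that does not vanish identically grows at least linearly; hence so do its
rescalings with exponent at least one. -/
theorem IsYoungFunction.exists_le_add_mul_rescale (hA : IsYoungFunction A) (hA0 : ∃ t, A t ≠ 0)
    {κ : ℝ} (hκ : 1 ≤ κ) : ∃ t₀ c : ℝ≥0, ∀ t, t ≤ t₀ + c * rescale A κ t := by
  obtain ⟨t₀, c, h⟩ := hA.exists_le_add_mul hA0
  refine ⟨1 + t₀, c, fun t => ?_⟩
  have h1 : t ≤ 1 + t ^ κ := by
    rcases le_total t 1 with ht | ht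
    · exact ht.trans (le_add_right le_rfl)
    · refine le_trans ?_ (le_add_left le_rfl)
      simpa using NNReal.rpow_le_rpow_of_exponent_le ht hκ
  calc t ≤ 1 + t ^ κ := h1
    _ ≤ 1 + (t₀ + c * A (t ^ κ)) := by gcongr; exact h _
    _ = _ := by rw [rescale, add_assoc]

theorem luxemburgNorm_le {g : EuclideanSpace ℝ (Fin n) → ℂ} {l : ℝ≥0} (hl : 0 < l)
    (h : ∫⁻ x, (A (‖g x‖₊ / l) : ℝ≥0∞) ≤ 1) : luxemburgNorm A g ≤ l :=
  iInf_le_of_le l (iInf_le_of_le hl (iInf_le_of_le h le_rfl))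

theorem exists_lt_of_luxemburgNorm_lt {g : EuclideanSpace ℝ (Fin n) → ℂ} {L : ℝ≥0∞}
    (h : luxemburgNorm A g < L) :
    ∃ l : ℝ≥0, 0 < l ∧ (l : ℝ≥0∞) < L ∧ ∫⁻ x, (A (‖g x‖₊ / l) : ℝ≥0∞) ≤ 1 := by
  simp only [luxemburgNorm, iInf_lt_iff] at h
  obtain ⟨l, hl, h1, h2⟩ := h
  exact ⟨l, hl, h2, h1⟩

/-- If `w` is pointwise at most a product of a power of the maximal function of `q` and a constant,
the maximal inequality bounds the Orlicz integral of `w` for the rescaled Young function. The first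
conclusion makes the conversion of `w` to `ℝ≥0` harmless. -/
theorem exists_lintegral_rescale_le_one (hn : 1 ≤ n) (hA : IsYoungFunction A)
    (hA0 : ∃ t, A t ≠ 0) (hA2 : Nabla2 A) {θ : ℝ} (hθ : θ < 1) (C : ℝ≥0) : ∃ C' : ℝ≥0, 0 < C' ∧
    ∀ (q : EuclideanSpace ℝ (Fin n) → ℝ≥0), Measurable q → ∀ l : ℝ≥0, 0 < l →
      ∫⁻ x, (A (q x / l) : ℝ≥0∞) ≤ 1 → ∀ c : ℝ≥0, 0 < c →
      ∀ w : EuclideanSpace ℝ (Fin n) → ℝ≥0∞,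
      (∀ x, maximalFun (fun y => (q y : ℝ≥0∞)) x < ⊤ →
        w x ≤ C * maximalFun (fun y => (q y : ℝ≥0∞)) x ^ (1 - θ) * c) →
      (∀ᵐ x, w x < ⊤) ∧
      ∫⁻ x, (rescale A (1 / (1 - θ)) ((w x).toNNReal / (C' * l ^ (1 - θ) * c)) : ℝ≥0∞) ≤ 1 := by
  have : Nonempty (Fin n) := ⟨⟨0, hn⟩⟩
  obtain ⟨K, hK0, hK⟩ := exists_lintegral_maximalFun_div_le_one
    (E := EuclideanSpace ℝ (Fin n)) hA hA0 hA2
  have hθ' : 0 < 1 - θ := by linarith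
  refine ⟨(C + 1) * K ^ (1 - θ), mul_pos (by positivity) (NNReal.rpow_pos hK0),
    fun q hq l hl hql c hc w hw => ?_⟩
  obtain ⟨h1, h2⟩ := hK (fun x => q x / l) (hq.div_const l) hql
  have hmax : ∀ x, maximalFun (fun y => (q y : ℝ≥0∞)) x
      = l * maximalFun (fun y => ((q y / l : ℝ≥0) : ℝ≥0∞)) x := fun x => by
    rw [← maximalFun_const_mul _ ENNReal.coe_ne_top]
    congr 1
    ext y
    rw [← ENNReal.coe_mul, mul_div_cancel₀ _ hl.ne']
  have hw' : ∀ᵐ x, w x < ⊤ ∧ w x ≤ C * maximalFun (fun y => (q y : ℝ≥0∞)) x ^ (1 - θ) * c := by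
    filter_upwards [h1] with x hx
    have hlt : maximalFun (fun y => (q y : ℝ≥0∞)) x < ⊤ := by
      rw [hmax]
      exact ENNReal.mul_lt_top ENNReal.coe_lt_top hx
    refine ⟨(hw x hlt).trans_lt ?_, hw x hlt⟩
    exact ENNReal.mul_lt_top (ENNReal.mul_lt_top ENNReal.coe_lt_top
      (ENNReal.rpow_lt_top_of_nonneg hθ'.le hlt.ne)) ENNReal.coe_lt_top
  refine ⟨hw'.mono fun x hx => hx.1, (lintegral_mono_ae ?_).trans h2⟩
  filter_upwards [hw', h1] with x hx hx1
  refine ENNReal.coe_le_coe.2 (hA.monotone ?_)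
  rw [hmax] at hx
  lift maximalFun (fun y => ((q y / l : ℝ≥0) : ℝ≥0∞)) x to ℝ≥0 using hx1.ne with M hM
  obtain ⟨hx2, hx3⟩ := hx
  lift w x to ℝ≥0 using hx2.ne with v hv
  rw [← ENNReal.coe_mul, ← ENNReal.coe_rpow_of_nonneg _ hθ'.le, ← ENNReal.coe_mul,
    ← ENNReal.coe_mul, ENNReal.coe_le_coe] at hx3
  rw [ENNReal.toNNReal_coe, ENNReal.toNNReal_coe, one_div]
  have h3 : v / ((C + 1) * K ^ (1 - θ) * l ^ (1 - θ) * c) ≤ (M / K) ^ (1 - θ) := by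
    have hKp : 0 < K ^ (1 - θ) := NNReal.rpow_pos hK0
    have hlp : 0 < l ^ (1 - θ) := NNReal.rpow_pos hl
    rw [NNReal.div_rpow, div_le_div_iff₀ (by positivity) hKp]
    calc v * K ^ (1 - θ) ≤ (C * (l * M) ^ (1 - θ) * c) * K ^ (1 - θ) := by gcongr
      _ ≤ ((C + 1) * (l * M) ^ (1 - θ) * c) * K ^ (1 - θ) := by
          gcongr; exact le_add_right le_rfl
      _ = _ := by rw [NNReal.mul_rpow]; ring
  calc _ ≤ ((M / K) ^ (1 - θ)) ^ (1 - θ)⁻¹ := NNReal.rpow_le_rpow h3 (inv_nonneg.2 hθ'.le)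
    _ = M / K := by rw [← NNReal.rpow_mul, mul_inv_cancel₀ hθ'.ne', NNReal.rpow_one]

end Orlicz

end

/-! ### The Sobolev-type inequality -/

theorem theorem5 (n : ℕ) (hn : 1 ≤ n)
    (A : ℝ≥0 → ℝ≥0) (hA : IsYoungFunction A) (hA0 : ∃ t, A t ≠ 0) (hA2 : Nabla2 A)
    (s s₁ β θ : ℝ) (hs₁ : 0 ≤ s₁) (hs : s₁ < s) (hβ : 0 < β) (hθ : θ = (s - s₁) / (β + s)) :
    ∃ C : ℝ≥0, ∀ (f F : 𝓢'(EuclideanSpace ℝ (Fin n), ℂ)) (g : EuclideanSpace ℝ (Fin n) → ℂ),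
      MemBesov β f → IsFracLaplacian s f F → IsGivenBy F g → MemOrlicz A g →
      ∃ (F₁ : 𝓢'(EuclideanSpace ℝ (Fin n), ℂ)) (g₁ : EuclideanSpace ℝ (Fin n) → ℂ),
        IsFracLaplacian s₁ f F₁ ∧ IsGivenBy F₁ g₁ ∧ MemOrlicz (rescale A (1 / (1 - θ))) g₁ ∧
        luxemburgNorm (rescale A (1 / (1 - θ))) g₁
          ≤ C * luxemburgNorm A g ^ (1 - θ) * besovNorm β f ^ θ := by
  have hθ0 : 0 < θ := by rw [hθ]; exact div_pos (by linarith) (by linarith)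
  have hθ1 : θ < 1 := by rw [hθ, div_lt_one (by linarith)]; linarith
  have hθ1' : 0 < 1 - θ := by linarith
  have hκ : 1 ≤ 1 / (1 - θ) := by rw [le_div_iff₀ hθ1']; linarith
  obtain ⟨C₁, hC₁⟩ := exists_tsum_enorm_freqBand_le n hs₁ hs hβ hθ
  obtain ⟨C, hC0, hC⟩ := exists_lintegral_rescale_le_one hn hA hA0 hA2 hθ1 C₁
  obtain ⟨C₂, hC₂⟩ := exists_norm_freqBand_le_besovNorm n s₁ β
  obtain ⟨t₀, c, htc⟩ := hA.exists_le_add_mul_rescale hA0 hκ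
  refine ⟨C, fun f F g hf hF hg hgA => ?_⟩
  have hB := rescale_monotone hA.monotone (zero_le_one.trans hκ)
  -- a measurable representative of the modulus of `g`
  obtain ⟨q, hq, hgq⟩ : ∃ q : EuclideanSpace ℝ (Fin n) → ℝ≥0, Measurable q ∧
      ∀ᵐ x, ‖g x‖₊ = q x :=
    ⟨fun x => ‖hgA.1.mk g x‖₊, hgA.1.stronglyMeasurable_mk.measurable.nnnorm, by
      filter_upwards [hgA.1.ae_eq_mk] with x hx
      rw [hx]⟩
  set w : EuclideanSpace ℝ (Fin n) → ℝ≥0∞ := fun x => ∑' j, ‖freqBand f s₁ j x‖ₑ with hw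
  have hmain : ∀ l b : ℝ≥0, 0 < l → ∫⁻ x, (A (‖g x‖₊ / l) : ℝ≥0∞) ≤ 1 → 0 < b →
      besovNorm β f ≤ b → (∀ᵐ x, w x < ⊤) ∧
      ∫⁻ x, (rescale A (1 / (1 - θ)) ((w x).toNNReal / (C * l ^ (1 - θ) * b ^ θ)) : ℝ≥0∞) ≤ 1 := by
    intro l b hl hgl hb hfb
    refine hC q hq l hl ?_ (b ^ θ) (NNReal.rpow_pos hb) w fun x hx => ?_
    · refine (lintegral_congr_ae ?_).trans_le hgl
      filter_upwards [hgq] with x hx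
      rw [hx]
    · rw [ENNReal.coe_rpow_of_nonneg _ hθ0.le]
      exact hC₁ f F g hF hg q hq hgq b hb hfb x hx
  have hpos : ∀ l b : ℝ≥0, 0 < l → 0 < b → 0 < C * l ^ (1 - θ) * b ^ θ := fun l b hl hb =>
    mul_pos (mul_pos hC0 (NNReal.rpow_pos hl)) (NNReal.rpow_pos hb)
  obtain ⟨l₀, hl₀, -, hgl₀⟩ := exists_lt_of_luxemburgNorm_lt hgA.2
  obtain ⟨b₀, hb₀, hfb₀⟩ : ∃ b : ℝ≥0, 0 < b ∧ besovNorm β f ≤ b :=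
    ⟨(besovNorm β f).toNNReal + 1, by positivity, by
      rw [ENNReal.coe_add, ENNReal.coe_toNNReal hf.ne]; exact le_add_right le_rfl⟩
  obtain ⟨hfin, hint⟩ := hmain l₀ b₀ hl₀ hgl₀ hb₀ hfb₀
  -- the series of the bands is dominated by a constant plus an integrable function
  set μ : ℝ≥0 := C * l₀ ^ (1 - θ) * b₀ ^ θ with hμ
  have hμ0 : 0 < μ := hpos _ _ hl₀ hb₀
  have hdom : ∀ᵐ x, w x ≤ ((μ * t₀ : ℝ≥0) : ℝ≥0∞) + ((μ * c : ℝ≥0) : ℝ≥0∞) *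
      (rescale A (1 / (1 - θ)) ((w x).toNNReal / μ) : ℝ≥0∞) := by
    filter_upwards [hfin] with x hx
    lift w x to ℝ≥0 using hx.ne with v
    rw [ENNReal.toNNReal_coe]
    norm_cast
    calc v = μ * (v / μ) := (mul_div_cancel₀ _ hμ0.ne').symm
      _ ≤ μ * (t₀ + c * rescale A (1 / (1 - θ)) (v / μ)) := by gcongr; exact htc _
      _ = _ := by ring
  obtain ⟨hmeas, hle, F₁, hF₁, hsum⟩ := exists_isGivenBy_tsum (u := freqBand f s₁)
    (continuous_freqBand f s₁) (h := fun x => ((μ * c : ℝ≥0) : ℝ≥0∞) *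
      (rescale A (1 / (1 - θ)) ((w x).toNNReal / μ) : ℝ≥0∞)) (by
      rw [lintegral_const_mul' _ _ ENNReal.coe_ne_top]
      exact ENNReal.mul_ne_top ENNReal.coe_ne_top (hint.trans_lt ENNReal.one_lt_top).ne) hfin hdom
  have hbound : ∀ l b : ℝ≥0, 0 < l → ∫⁻ x, (A (‖g x‖₊ / l) : ℝ≥0∞) ≤ 1 → 0 < b →
      besovNorm β f ≤ b →
      luxemburgNorm (rescale A (1 / (1 - θ))) (fun x => ∑' j, freqBand f s₁ j x)
        ≤ (C : ℝ≥0∞) * (l : ℝ≥0∞) ^ (1 - θ) * (b : ℝ≥0∞) ^ θ := by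
    intro l b hl hgl hb hfb
    rw [← ENNReal.coe_rpow_of_nonneg _ hθ1'.le, ← ENNReal.coe_rpow_of_nonneg _ hθ0.le,
      ← ENNReal.coe_mul, ← ENNReal.coe_mul]
    refine luxemburgNorm_le (hpos l b hl hb)
      ((lintegral_mono_ae ?_).trans (hmain l b hl hgl hb hfb).2)
    filter_upwards [hle, hfin] with x h1 h2
    refine ENNReal.coe_le_coe.2 (hB ?_)
    gcongr
    rw [← ENNReal.coe_le_coe, ENNReal.coe_toNNReal h2.ne]
    exact h1
  have hfinal : luxemburgNorm (rescale A (1 / (1 - θ))) (fun x => ∑' j, freqBand f s₁ j x)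
      ≤ C * luxemburgNorm A g ^ (1 - θ) * besovNorm β f ^ θ := by
    -- approximate the two norms from above by admissible constants
    have h1 : ∀ L > luxemburgNorm A g, ∀ B > besovNorm β f,
        luxemburgNorm (rescale A (1 / (1 - θ))) (fun x => ∑' j, freqBand f s₁ j x)
          ≤ C * L ^ (1 - θ) * B ^ θ := by
      intro L hL B hB
      obtain ⟨l, hl, hlL, hgl⟩ := exists_lt_of_luxemburgNorm_lt hL
      obtain ⟨b, hfb, hbB⟩ := ENNReal.lt_iff_exists_nnreal_btwn.1 hB
      have hb : 0 < b := ENNReal.coe_pos.1 (zero_le.trans_lt hfb)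
      refine (hbound l b hl hgl hb hfb.le).trans ?_
      gcongr
    have := nhdsGT_neBot_of_exists_gt ⟨_, hgA.2⟩
    have := nhdsGT_neBot_of_exists_gt ⟨_, hf⟩
    have h2 : ∀ L > luxemburgNorm A g, L < ⊤ →
        luxemburgNorm (rescale A (1 / (1 - θ))) (fun x => ∑' j, freqBand f s₁ j x)
          ≤ C * L ^ (1 - θ) * besovNorm β f ^ θ := by
      intro L hL hLt
      have hlim : Tendsto (fun B : ℝ≥0∞ => C * L ^ (1 - θ) * B ^ θ) (𝓝[>] besovNorm β f)
          (𝓝 (C * L ^ (1 - θ) * besovNorm β f ^ θ)) :=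
        (ENNReal.Tendsto.const_mul ENNReal.continuous_rpow_const.continuousAt (Or.inr
          (ENNReal.mul_ne_top ENNReal.coe_ne_top
            (ENNReal.rpow_ne_top_of_nonneg hθ1'.le hLt.ne)))).mono_left nhdsWithin_le_nhds
      exact ge_of_tendsto hlim (eventually_mem_nhdsWithin.mono fun B hB => h1 L hL B hB)
    have hlim : Tendsto (fun L : ℝ≥0∞ => C * L ^ (1 - θ) * besovNorm β f ^ θ)
        (𝓝[>] luxemburgNorm A g) (𝓝 (C * luxemburgNorm A g ^ (1 - θ) * besovNorm β f ^ θ)) :=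
      (ENNReal.Tendsto.mul_const (ENNReal.Tendsto.const_mul
        ENNReal.continuous_rpow_const.continuousAt (Or.inr ENNReal.coe_ne_top))
        (Or.inr (ENNReal.rpow_ne_top_of_nonneg hθ0.le hf.ne))).mono_left nhdsWithin_le_nhds
    exact ge_of_tendsto hlim (by
      filter_upwards [Ioo_mem_nhdsGT hgA.2] with L hL using h2 L hL.1 hL.2)
  refine ⟨F₁, fun x => ∑' j, freqBand f s₁ j x, ⟨fun φ ψ hφ hψ =>
    fourier_eq_of_hasSum_freqBand hsum hφ hψ, ?_⟩, hF₁, ⟨hmeas, hfinal.trans_lt ?_⟩, hfinal⟩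
  · refine vanishesAtZeroFrequency_of_hasSum_freqBand (p := s₁ + β) (by linarith) hsum
      (B := C₂ * b₀) fun j x => (hC₂ f b₀ hfb₀ j x).trans_eq ?_
    rw [NNReal.coe_mul]
    ring
  · exact ENNReal.mul_lt_top (ENNReal.mul_lt_top ENNReal.coe_lt_top
      (ENNReal.rpow_lt_top_of_nonneg hθ1'.le hgA.2.ne))
      (ENNReal.rpow_lt_top_of_nonneg hθ0.le hf.ne)
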